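/- Let $m\ge 1$. For $n\in\mathbb{Z}$ let $A(n)\in\mathbb{C}^{m\times m}$ be invertible and $B(n)\in\mathbb{C}^{m\times m}$ Hermitian, with $A(n)\to-\mathbb{I}$ as $|n|\to\infty$ and with $\|A(n)\|$, $\|B(n)\|$ uniformly bounded. Let $W$ be the bounded operator on $\ell^2(\mathbb{Z},\mathbb{C}^m)$ given by $$(Wu)(n)=A(n-1)^*u(n-1)+A(n)u(n+1)+B(n)u(n).$$ Then $W$ is self-adjoint. Let $\lambda_j$ be the distinct eigenvalues of $W$ outside $[-2,2]$, with multiplicities $m_j=\dim\ker(W-\lambda_j)$, and let $k_j\in\mathbb{R}$ be defined by $\lambda_j=-k_j-\frac1{k_j}$, $|k_j|>1$. The multiplicities satisfy $m_j\le m$. Assume that $\sum_{n\in\mathbb{Z}}\operatorname{tr}(B(n)^2)<\infty$ and that $\sum_{n\in\mathbb{Z}}\big[\operatorname{tr}(A(n)A(n)^*-\mathbb{I})-\log\det(A(n)A(n)^*)\big]<\infty$ (the terms of both series are non-negative). Then $$\sum_j m_j\Big(k_j^2-\frac1{k_j^2}-\log|k_j|^4\Big)\le\sum_{n\in\mathbb{Z}}\operatorname{tr}\big(B(n)^2\big)+2\sum_{n\in\mathbb{Z}}\Big[\operatorname{tr}\big(A(n)A(n)^*-\mathbb{I}\big)-\log\det\big(A(n)A(n)^*\big)\Big],$$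 where the series on the left converges. The inequality is sharp: for every $m\ge1$ and every $k>1$ there are $A$, $B$ satisfying all the assumptions for which $-k-\frac1k$ is the only eigenvalue of $W$ outside $[-2,2]$, both sums on the right-hand side are positive, and equality holds. In particular, if $A(n)=-\mathbb{I}$ for all $n$ and $\sum_{n}\operatorname{tr}(B(n)^2)<\infty$, then $$\sum_j m_j\Big(k_j^2-\frac1{k_j^2}-\log|k_j|^4\Big)\le\sum_{n\in\mathbb{Z}}\operatorname{tr}\big(B(n)^2\big).$$ -/

import Mathlib

open Filter Topology
open scoped Matrix

noncomputable section

/-- The Hilbert space `ℓ²(ℤ, ℂ^m)`, with the Euclidean norm on `ℂ^m`. -/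
abbrev SeqSpace (m : ℕ) : Type :=
  lp (fun _ : ℤ => EuclideanSpace ℂ (Fin m)) 2

/-- The action of a complex `m × m` matrix on `ℂ^m` with its Euclidean norm, so that
`‖matOp M‖` is the operator norm of `M`. -/
abbrev matOp {m : ℕ} (M : Matrix (Fin m) (Fin m) ℂ) :
    EuclideanSpace ℂ (Fin m) →L[ℂ] EuclideanSpace ℂ (Fin m) :=
  Matrix.toEuclideanCLM (n := Fin m) (𝕜 := ℂ) M

theorem weightedShift_hasSum {m : ℕ} (u : SeqSpace m) (s : ℤ) :
    HasSum (fun n : ℤ => ‖u (n + s)‖ ^ (2 : ENNReal).toReal) (‖u‖ ^ (2 : ENNReal).toReal) :=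
  (Equiv.addRight s).hasSum_iff.mpr (lp.hasSum_norm (by norm_num) u)

theorem weightedShift_bound {m : ℕ} (T : ℤ → Matrix (Fin m) (Fin m) ℂ) {C : ℝ}
    (hC : ∀ n, ‖matOp (T n)‖ ≤ C) (s : ℤ) (u : SeqSpace m) (n : ℤ) :
    ‖matOp (T n) (u (n + s))‖ ^ (2 : ENNReal).toReal
      ≤ C ^ (2 : ENNReal).toReal * ‖u (n + s)‖ ^ (2 : ENNReal).toReal := by
  have h0 : 0 ≤ C := (norm_nonneg _).trans (hC n)
  rw [← Real.mul_rpow h0 (norm_nonneg _)]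
  exact Real.rpow_le_rpow (norm_nonneg _)
    (((matOp (T n)).le_opNorm _).trans (mul_le_mul_of_nonneg_right (hC n) (norm_nonneg _)))
    (by norm_num)

theorem weightedShift_mem {m : ℕ} (T : ℤ → Matrix (Fin m) (Fin m) ℂ)
    (hT : ∃ C : ℝ, ∀ n, ‖matOp (T n)‖ ≤ C) (s : ℤ) (u : SeqSpace m) :
    Memℓp (fun n : ℤ => matOp (T n) (u (n + s))) 2 := by
  obtain ⟨C, hC⟩ := hT
  exact memℓp_gen (Summable.of_nonneg_of_le (fun n => Real.rpow_nonneg (norm_nonneg _) _)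
    (weightedShift_bound T hC s u) ((weightedShift_hasSum u s).summable.mul_left _))

/-- The bounded operator `(S u)(n) = T(n) u(n + s)` on `ℓ²(ℤ, ℂ^m)`, for bounded `T`. -/
def weightedShift {m : ℕ} (T : ℤ → Matrix (Fin m) (Fin m) ℂ)
    (hT : ∃ C : ℝ, ∀ n, ‖matOp (T n)‖ ≤ C) (s : ℤ) : SeqSpace m →L[ℂ] SeqSpace m :=
  LinearMap.mkContinuousOfExistsBound
    { toFun := fun u => ⟨fun n => matOp (T n) (u (n + s)), weightedShift_mem T hT s u⟩
      map_add' := fun u v => by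
        ext1; funext n
        exact (matOp (T n)).map_add _ _
      map_smul' := fun c u => by
        ext1; funext n
        exact (matOp (T n)).map_smul _ _ }
    (by
      obtain ⟨C, hC⟩ := hT
      have h0 : 0 ≤ C := (norm_nonneg _).trans (hC 0)
      refine ⟨C, fun u => lp.norm_le_of_tsum_le (by norm_num)
        (mul_nonneg h0 (norm_nonneg _)) ?_⟩
      rw [Real.mul_rpow h0 (norm_nonneg _), ← (weightedShift_hasSum u s).tsum_eq, ← tsum_mul_left]
      exact Summable.tsum_le_tsum (weightedShift_bound T hC s u)
        (weightedShift_mem T ⟨C, hC⟩ s u |>.summable (by norm_num))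
        ((weightedShift_hasSum u s).summable.mul_left _))

/-- The coefficients of a Jacobi operator with matrix-valued entries on `ℓ²(ℤ, ℂ^m)`:
invertible off-diagonal blocks `A(n) → -I` as `|n| → ∞`, Hermitian blocks `B(n)`, and
uniformly bounded norms. -/
structure MatrixJacobi (m : ℕ) where
  /-- off-diagonal entries -/
  A : ℤ → Matrix (Fin m) (Fin m) ℂ
  /-- potential -/
  B : ℤ → Matrix (Fin m) (Fin m) ℂ
  isUnit_A : ∀ n, IsUnit (A n)
  isHermitian_B : ∀ n, (B n).IsHermitian
  tendsto_A : Tendsto A cofinite (𝓝 (-1))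
  bounded_A : ∃ C : ℝ, ∀ n, ‖matOp (A n)‖ ≤ C
  bounded_B : ∃ C : ℝ, ∀ n, ‖matOp (B n)‖ ≤ C

namespace MatrixJacobi

variable {m : ℕ} (J : MatrixJacobi m)

theorem bounded_A_conjTranspose :
    ∃ C : ℝ, ∀ n : ℤ, ‖matOp (J.A (n - 1))ᴴ‖ ≤ C := by
  obtain ⟨C, hC⟩ := J.bounded_A
  refine ⟨C, fun n => ?_⟩
  have h : matOp (J.A (n - 1))ᴴ = star (matOp (J.A (n - 1))) :=
    map_star (Matrix.toEuclideanCLM (n := Fin m) (𝕜 := ℂ)) (J.A (n - 1))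
  rw [h, ContinuousLinearMap.star_eq_adjoint, LinearIsometryEquiv.norm_map]
  exact hC _

/-- The bounded operator
`(W u)(n) = A(n-1)* u(n-1) + A(n) u(n+1) + B(n) u(n)` on `ℓ²(ℤ, ℂ^m)`. -/
def W : SeqSpace m →L[ℂ] SeqSpace m :=
  weightedShift (fun n => (J.A (n - 1))ᴴ) J.bounded_A_conjTranspose (-1)
    + weightedShift J.A J.bounded_A 1 + weightedShift J.B J.bounded_B 0

theorem W_apply (u : SeqSpace m) (n : ℤ) :
    J.W u n = matOp (J.A (n - 1))ᴴ (u (n - 1)) + matOp (J.A n) (u (n + 1))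
      + matOp (J.B n) (u n) := by
  have h : J.W u n = matOp (J.A (n - 1))ᴴ (u (n + -1)) + matOp (J.A n) (u (n + 1))
      + matOp (J.B n) (u (n + 0)) := rfl
  rw [h, add_zero, ← sub_eq_add_neg]

/-- The eigenspace of `W` for a real number `lam`. -/
def eigenspace (lam : ℝ) : Submodule ℂ (SeqSpace m) :=
  Module.End.eigenspace (J.W : SeqSpace m →ₗ[ℂ] SeqSpace m) (lam : ℂ)

/-- The set of eigenvalues of `W` outside `[-2, 2]`. -/
def outerEigenvalues : Set ℝ :=
  {lam | 2 < |lam| ∧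
    Module.End.HasEigenvalue (J.W : SeqSpace m →ₗ[ℂ] SeqSpace m) (lam : ℂ)}

/-- The multiplicity of `lam` as an eigenvalue of `W`. -/
def multiplicity (lam : ℝ) : ℕ := Module.finrank ℂ (J.eigenspace lam)

end MatrixJacobi

/-- The number `k` with `|k| > 1` and `lam = -k - 1/k`, for `|lam| > 2`. -/
def kOf (lam : ℝ) : ℝ :=
  if 0 < lam then -(lam + √(lam ^ 2 - 4)) / 2 else (-lam + √(lam ^ 2 - 4)) / 2

/-- For `|lam| > 2`, `kOf lam` is the unique `k` with `|k| > 1` and `lam = -k - 1/k`. -/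
theorem kOf_unique {lam : ℝ} (h : 2 < |lam|) (k : ℝ) :
    (1 < |k| ∧ lam = -k - 1 / k) ↔ k = kOf lam := by
  have h4 : 0 < lam ^ 2 - 4 := by nlinarith [sq_abs lam]
  have hs := Real.sq_sqrt h4.le
  have hp := Real.sqrt_pos.mpr h4
  constructor
  · rintro ⟨hk, hl⟩
    have hk0 : k ≠ 0 := by rintro rfl; norm_num at hk
    have hkl : lam * k = -k ^ 2 - 1 := by rw [hl]; field_simp
    have hk2 : 1 < k ^ 2 := by nlinarith [sq_abs k]
    have hd : (2 * k + lam) ^ 2 = lam ^ 2 - 4 := by nlinarith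
    have hd1 : k * (2 * k + lam) = k ^ 2 - 1 := by nlinarith
    unfold kOf
    rcases lt_abs.mp hk with hk' | hk'
    · have hl0 : lam < 0 := by
        by_contra hc
        nlinarith [mul_nonneg (not_lt.mp hc) (by linarith : 0 ≤ k)]
      have hq : √(lam ^ 2 - 4) = 2 * k + lam := by
        rw [← hd]
        exact Real.sqrt_sq (by by_contra hc; nlinarith [not_le.mp hc])
      rw [if_neg hl0.not_gt, hq]
      ring
    · have hl0 : 0 < lam := by
        by_contra hc
        nlinarith [mul_nonneg_of_nonpos_of_nonpos (not_lt.mp hc) (by linarith : k ≤ 0)]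
      have hq : √(lam ^ 2 - 4) = -(2 * k + lam) := by
        rw [← hd, ← neg_sq]
        exact Real.sqrt_sq (by by_contra hc; nlinarith [not_le.mp hc])
      rw [if_pos hl0, hq]
      ring
  · rintro rfl
    unfold kOf
    rcases lt_abs.mp h with h' | h'
    · rw [if_pos (by linarith)]
      constructor
      · rw [lt_abs]; right; linarith
      · rw [eq_sub_iff_add_eq, eq_comm, ← sub_eq_iff_eq_add', eq_div_iff (by linarith)]
        nlinarith
    · rw [if_neg (by linarith)]
      constructor
      · rw [lt_abs]; left; linarith
      · rw [eq_sub_iff_add_eq, eq_comm, ← sub_eq_iff_eq_add', eq_div_iff (by linarith)]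
        nlinarith

namespace MatrixJacobi

variable {m : ℕ} (J : MatrixJacobi m)

/-- The contribution `m_j (k_j² - 1/k_j² - log |k_j|⁴)` of an eigenvalue `lam`. -/
def eigenTerm (lam : ℝ) : ℝ :=
  J.multiplicity lam *
    (kOf lam ^ 2 - 1 / kOf lam ^ 2 - Real.log (|kOf lam| ^ 4))

/-- The number `tr (B(n)²)`, which is real since `B(n)` is Hermitian. -/
def potentialTerm (n : ℤ) : ℝ := (J.B n ^ 2).trace.re

/-- The number `tr (A(n) A(n)* - I) - log det (A(n) A(n)*)`; the trace and the determinant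
are real, and the determinant is positive since `A(n)` is invertible. -/
def offDiagonalTerm (n : ℤ) : ℝ :=
  (J.A n * (J.A n)ᴴ - 1).trace.re - Real.log (J.A n * (J.A n)ᴴ).det.re

end MatrixJacobi

end

/-! The inequality is a limit of one about finite Hermitian matrices. Cut `W` to the sites `-N, …,
N`, close them to a ring and put a phase `ω` on each edge. This gives `M_ω = ωX + ω̄X* + D`, where
`X` is a block shift and `D` is block diagonal. On at least three sites `tr M_ω² = tr D² + 2 tr XX*`
for every `|ω| = 1`. By Jensen's formula the mean over `ω` of `log |det (M_ω - x)|` is at least `log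
|det X|`, for every `x` (`Matrix.log_norm_det_le_circleAverage_twist`).

Average over `x` with respect to the semicircle law on `[-2, 2]`, whose logarithmic potential is
`U`. The function `F(μ) = μ² - 2 - 4U(μ)` vanishes on `[-2, 2]` and equals `κ² - κ⁻² - 4 log κ` at
`|μ| = κ + 1/κ`. It is convex, so it lies above its tangents. For a suitable `ω`, the sum of `F`
over the spectrum of `M_ω` is at most `tr D² + 2 tr XX* - 2 dim - 4 log |det X|`, which is the
right-hand side summed over `-N, …, N`. Moving the law off the real axis by `iε` keeps all
logarithms finite at a cost of order `ε` per eigenvalue.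

An eigenvector of `W`, cut to the ring and multiplied by `ω̄^j` at site `j`, satisfies the
eigenvalue equation of `M_ω` except at the two end sites, where it is small. Tangents to `F` and
Bessel's inequality then bound the sum of the eigenvalue weights by the sum of `F`
(`Matrix.IsHermitian.sum_affine_le_sum`). Let `ε → 0`, then `N → ∞`.

Equality is attained by one-soliton operators, built from the positive solution `k^n + k^(-n)` of
the free equation: their right-hand side telescopes to the weight of a single eigenvalue of
multiplicity `m`. -/

noncomputable section

/-! ### Logarithmic potential of the shifted semicircle law -/

open Complex in
/-- The circle average of `log ‖1 - a z‖` against the weight `1 - Re z²`. -/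
theorem circleAverage_weight_mul_log_norm_one_sub {a : ℂ} (ha : ‖a‖ < 1) :
    Real.circleAverage (fun z : ℂ => (1 - (z ^ 2).re) * Real.log ‖1 - a * z‖) 0 1
      = (a ^ 2).re / 4 := by
  set h : ℂ → ℂ := fun z => log (1 - a * z) with hh
  have hslit : ∀ z ∈ Metric.closedBall (0 : ℂ) 1, 1 - a * z ∈ slitPlane := by
    intro z hz
    have hz1 : ‖a * z‖ < 1 := by
      rw [norm_mul]
      have : ‖z‖ ≤ 1 := by simpa using hz
      nlinarith [norm_nonneg a, norm_nonneg z]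
    left
    have := (abs_le.mp (abs_re_le_norm (a * z))).2
    simp only [sub_re, one_re]
    linarith
  have hd : ∀ z ∈ Metric.closedBall (0 : ℂ) 1, HasDerivAt h (-a / (1 - a * z)) z := by
    intro z hz
    have h1 : HasDerivAt (fun z : ℂ => 1 - a * z) (-a) z := by
      simpa using ((hasDerivAt_id z).const_mul a).const_sub 1
    exact h1.clog (hslit z hz)
  have hdiff : DifferentiableOn ℂ h (Metric.closedBall (0 : ℂ) 1) :=
    fun z hz => (hd z hz).differentiableAt.differentiableWithinAt
  have hcont : ContinuousOn h (Metric.sphere (0 : ℂ) 1) :=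
    hdiff.continuousOn.mono Metric.sphere_subset_closedBall
  have hcl : DiffContOnCl ℂ h (Metric.ball 0 |1|) := by
    rw [abs_one]
    exact hdiff.diffContOnCl_ball le_rfl
  -- On the circle `1 - Re z² = (1 - z²/2) - z⁻²/2`. Against `h`, the first part averages to `h 0 =
  -- 0` by the mean value property, and `z⁻²` extracts the Taylor coefficient `h''(0)/2 = -a²/2`.
  have hcl' : DiffContOnCl ℂ (fun z => h z * (1 - z ^ 2 / 2)) (Metric.ball 0 |1|) := by
    rw [abs_one]
    exact (hdiff.mul (by fun_prop)).diffContOnCl_ball le_rfl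
  have havg1 : Real.circleAverage (fun z => h z * (1 - z ^ 2 / 2)) 0 1 = 0 := by
    rw [hcl'.circleAverage]; simp [hh]
  have hder : iteratedDeriv 2 h 0 = -a ^ 2 := by
    rw [iteratedDeriv_succ, iteratedDeriv_one]
    have hev : deriv h =ᶠ[𝓝 0] fun z => -a / (1 - a * z) := by
      filter_upwards [Metric.closedBall_mem_nhds (0 : ℂ) one_pos] with z hz
      exact (hd z hz).deriv
    rw [hev.deriv_eq]
    have h1 : HasDerivAt (fun z : ℂ => 1 - a * z) (-a) 0 := by
      simpa using ((hasDerivAt_id (0 : ℂ)).const_mul a).const_sub 1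
    have h2 := (hasDerivAt_const (0 : ℂ) (-a)).div h1 (by simp)
    rw [show (fun z => -a / (1 - a * z)) = (fun _ => -a) / (fun z => 1 - a * z) from rfl, h2.deriv]
    simp; ring
  have havg2 : Real.circleAverage (fun z => h z * (z⁻¹) ^ 2) 0 1 = -a ^ 2 / 2 := by
    rw [Real.circleAverage_eq_circleIntegral (by norm_num)]
    have := hcl.circleIntegral_one_div_sub_center_pow_smul (by norm_num) 2
    rw [hder] at this
    have e : (fun z : ℂ => (z - 0)⁻¹ • (h z * (z⁻¹) ^ 2))
        = fun z => (1 / (z - 0) ^ (2 + 1)) • h z := by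
      funext z; simp only [sub_zero, smul_eq_mul, one_div, inv_pow]; ring
    rw [abs_one] at this
    rw [e, this]
    have : (2 * (Real.pi : ℂ) * I) ≠ 0 := by simp [Real.pi_ne_zero]
    simp only [Nat.factorial, smul_eq_mul]
    field_simp
    push_cast; ring
  have hi1 : CircleIntegrable (fun z => h z * (1 - z ^ 2 / 2)) 0 1 :=
    ContinuousOn.circleIntegrable zero_le_one (hcont.mul (by fun_prop))
  have hi2 : CircleIntegrable (fun z => h z * (z⁻¹) ^ 2) 0 1 := by
    refine ContinuousOn.circleIntegrable zero_le_one (hcont.mul ?_)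
    refine (ContinuousOn.inv₀ continuousOn_id ?_).pow 2
    intro z hz h0
    simp only [id] at h0
    simp [h0] at hz
  have hi3 : CircleIntegrable (fun z => (2⁻¹ : ℝ) • (h z * (z⁻¹) ^ 2)) 0 1 :=
    by simpa [Complex.real_smul] using (hi2.const_fun_smul (a := (2⁻¹ : ℂ)))
  have key : Real.circleAverage (fun z => h z * (1 - z ^ 2 / 2) - (2⁻¹ : ℝ) • (h z * (z⁻¹) ^ 2)) 0 1
      = a ^ 2 / 4 := by
    rw [Real.circleAverage_fun_sub hi1 hi3, havg1, Real.circleAverage_fun_smul, havg2]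
    simp; ring
  have hre := Complex.reCLM.circleAverage_comp_comm (hi1.sub hi3)
  simp only [Pi.sub_def] at hre
  rw [key] at hre
  rw [show (a ^ 2).re / 4 = Complex.reCLM (a ^ 2 / 4) by simp, ← hre]
  refine Real.circleAverage_congr_sphere fun z hz => ?_
  have hz1 : ‖z‖ = 1 := by simpa using hz
  have hinv : z⁻¹ = (starRingEnd ℂ) z := inv_eq_conj hz1
  simp only [Function.comp, Complex.reCLM_apply, hh, hinv, ← Complex.log_re]
  simp [pow_two]
  ring

theorem circleAverage_weight_mul_log_norm_one_sub_inv {a : ℂ} (ha : ‖a‖ < 1) :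
    Real.circleAverage (fun z : ℂ => (1 - (z ^ 2).re) * Real.log ‖1 - a * z⁻¹‖) 0 1
      = (a ^ 2).re / 4 := by
  rw [← circleAverage_weight_mul_log_norm_one_sub ha, ← Real.circleAverage_zero_one_congr_inv]
  refine Real.circleAverage_congr_sphere fun z hz => ?_
  have hz1 : ‖z‖ = 1 := by simpa using hz
  have hinv : z⁻¹ = (starRingEnd ℂ) z := Complex.inv_eq_conj hz1
  simp only [inv_inv]
  rw [hinv, ← map_pow, Complex.conj_re]

theorem circleAverage_weight : Real.circleAverage (fun z : ℂ => 1 - (z ^ 2).re) 0 1 = 1 := by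
  have h : DiffContOnCl ℂ (fun z : ℂ => 1 - z ^ 2) (Metric.ball 0 |1|) := by
    have : Differentiable ℂ (fun z : ℂ => 1 - z ^ 2) := by fun_prop
    exact this.diffContOnCl
  have hi : CircleIntegrable (fun z : ℂ => 1 - z ^ 2) 0 1 :=
    ContinuousOn.circleIntegrable zero_le_one (by fun_prop)
  have := Complex.reCLM.circleAverage_comp_comm hi
  rw [h.circleAverage] at this
  simpa [Function.comp_def] using this


/-- The logarithmic potential at `μ` of the semicircle law on `[-2, 2]` shifted by `i ε`. -/
def semicirclePotential (ε μ : ℝ) : ℝ :=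
  Real.circleAverage
    (fun z : ℂ => (1 - (z ^ 2).re) * Real.log ‖(μ : ℂ) - ((2 * z.re : ℝ) + ε * Complex.I)‖) 0 1

/-- The roots of `b² - wb + 1` have product `1`. Neither lies on the unit circle, where `b + b⁻¹ = b
+ b̄` is real while `w` is not, so one of them lies inside. -/
theorem exists_joukowski_preimage {ε : ℝ} (hε : ε ≠ 0) (μ : ℝ) :
    ∃ a : ℂ, a ≠ 0 ∧ ‖a‖ < 1 ∧ a + a⁻¹ = μ - ε * Complex.I := by
  set w : ℂ := μ - ε * Complex.I with hw
  obtain ⟨s, hs⟩ := IsAlgClosed.exists_eq_mul_self (w ^ 2 - 4)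
  set b : ℂ := (w + s) / 2 with hb
  have hb1 : b * (w - b) = 1 := by
    rw [hb]; linear_combination (-1 / 4 : ℂ) * (-hs)
  have hb0 : b ≠ 0 := left_ne_zero_of_mul_eq_one hb1
  have hinv : b⁻¹ = w - b := inv_eq_of_mul_eq_one_right hb1
  have hsum : b + b⁻¹ = w := by rw [hinv]; ring
  have hne : ‖b‖ ≠ 1 := by
    intro h1
    rw [Complex.inv_eq_conj h1, Complex.add_conj, hw] at hsum
    have := congrArg Complex.im hsum
    simp at this
    exact hε this
  rcases lt_or_gt_of_ne hne with h | h
  · exact ⟨b, hb0, h, hsum⟩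
  · refine ⟨b⁻¹, inv_ne_zero hb0, ?_, by rw [inv_inv, add_comm, hsum]⟩
    rw [norm_inv]
    exact inv_lt_one_of_one_lt₀ h

/-- On the circle `2 Re z = z + z⁻¹`, so `μ - x = (1 - az)(1 - a/z)/a`. Each of the first two
factors contributes `Re a² / 4`. -/
theorem semicirclePotential_eq {ε μ : ℝ} {a : ℂ} (ha0 : a ≠ 0) (ha1 : ‖a‖ < 1)
    (ha : a + a⁻¹ = μ - ε * Complex.I) :
    semicirclePotential ε μ = (a ^ 2).re / 2 - Real.log ‖a‖ := by
  have hne : ∀ z ∈ Metric.sphere (0 : ℂ) 1, 1 - a * z ≠ 0 := by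
    intro z hz h
    have hz1 : ‖z‖ = 1 := by simpa using hz
    have : ‖a * z‖ = 1 := by rw [← sub_eq_zero.mp h, norm_one]
    rw [norm_mul, hz1, mul_one] at this
    exact ha1.ne this
  have hne' : ∀ z ∈ Metric.sphere (0 : ℂ) 1, 1 - a * z⁻¹ ≠ 0 := fun z hz =>
    hne z⁻¹ (by simpa using hz)
  have hz0 : ∀ z ∈ Metric.sphere (0 : ℂ) 1, z ≠ 0 := by
    rintro z hz rfl
    simp at hz
  have hi1 : CircleIntegrable (fun z : ℂ => (1 - (z ^ 2).re) * Real.log ‖1 - a * z‖) 0 1 := by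
    refine ContinuousOn.circleIntegrable zero_le_one (ContinuousOn.mul (by fun_prop) ?_)
    exact ContinuousOn.log (by fun_prop) fun z hz => norm_ne_zero_iff.mpr (hne z hz)
  have hi2 : CircleIntegrable (fun z : ℂ => (1 - (z ^ 2).re) * Real.log ‖1 - a * z⁻¹‖) 0 1 := by
    refine ContinuousOn.circleIntegrable zero_le_one (ContinuousOn.mul (by fun_prop) ?_)
    refine ContinuousOn.log (ContinuousOn.norm (continuousOn_const.sub (continuousOn_const.mul
      (continuousOn_id.inv₀ hz0)))) fun z hz => norm_ne_zero_iff.mpr (hne' z hz)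
  have hi3 : CircleIntegrable (fun z : ℂ => Real.log ‖a‖ • (1 - (z ^ 2).re)) 0 1 :=
    ContinuousOn.circleIntegrable zero_le_one (by fun_prop)
  have key := Real.circleAverage_fun_sub (hi1.add hi2) hi3
  simp only [Pi.add_apply] at key
  rw [Real.circleAverage_add hi1 hi2, circleAverage_weight_mul_log_norm_one_sub ha1,
    circleAverage_weight_mul_log_norm_one_sub_inv ha1, Real.circleAverage_fun_smul,
    circleAverage_weight] at key
  rw [semicirclePotential]
  trans (a ^ 2).re / 4 + (a ^ 2).re / 4 - Real.log ‖a‖ • 1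
  · rw [← key]
    refine Real.circleAverage_congr_sphere fun z hz => ?_
    rw [abs_one] at hz
    have hz1 : ‖z‖ = 1 := by simpa using hz
    have e : (μ : ℂ) - ((2 * z.re : ℝ) + ε * Complex.I) = (1 - a * z) * (1 - a * z⁻¹) / a := by
      have h2 : ((2 * z.re : ℝ) : ℂ) = z + z⁻¹ := by
        rw [Complex.inv_eq_conj hz1, Complex.add_conj]
      have := hz0 z hz
      rw [h2, ← sub_sub, sub_right_comm, ← ha]
      field_simp
      ring
    simp only [smul_eq_mul]
    rw [e, norm_div, norm_mul, Real.log_div, Real.log_mul]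
    · ring
    · exact norm_ne_zero_iff.mpr (hne z hz)
    · exact norm_ne_zero_iff.mpr (hne' z hz)
    · exact mul_ne_zero (norm_ne_zero_iff.mpr (hne z hz)) (norm_ne_zero_iff.mpr (hne' z hz))
    · exact norm_ne_zero_iff.mpr ha0
  · rw [smul_eq_mul]; ring

/-! ### Convexity of the eigenvalue weight -/

/-- The eigenvalue weight `κ² - κ⁻² - 4 log κ`. -/
def moment (κ : ℝ) : ℝ := κ ^ 2 - 1 / κ ^ 2 - 4 * Real.log κ

/-- As a function of `ρ + 1 / ρ`, the function `moment` is convex. -/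
theorem moment_tangent_le {κ ρ : ℝ} (hκ : 1 ≤ κ) (hρ : 1 ≤ ρ) :
    moment κ + 2 * (κ - 1 / κ) * ((ρ + 1 / ρ) - (κ + 1 / κ)) ≤ moment ρ := by
  set f : ℝ → ℝ := fun t => moment t - 2 * (κ - 1 / κ) * (t + 1 / t) with hf
  suffices f κ ≤ f ρ by simp only [hf] at this; linarith
  -- The derivative of `moment` with respect to `t + 1/t` is `2(t - 1/t)`, which increases; hence
  -- `f'` has the sign of `t - κ`.
  have hd : ∀ t : ℝ, 1 ≤ t →
      HasDerivAt f (2 * (1 - 1 / t ^ 2) * ((t - κ) * (1 + 1 / (t * κ)))) t := by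
    intro t ht
    have ht0 : t ≠ 0 := by positivity
    have hκ0 : κ ≠ 0 := by positivity
    have h1 : HasDerivAt (fun t : ℝ => t ^ 2) (2 * t) t := by simpa using hasDerivAt_pow 2 t
    have h2 : HasDerivAt (fun t : ℝ => 1 / t ^ 2) (-(2 * t) / (t ^ 2) ^ 2) t := by
      simpa [Pi.inv_def] using h1.inv (by positivity)
    have h3 : HasDerivAt (fun t : ℝ => 1 / t) (-1 / t ^ 2) t := by
      simpa [Pi.inv_def] using (hasDerivAt_id t).inv ht0
    have := ((h1.sub h2).sub ((Real.hasDerivAt_log ht0).const_mul 4)).sub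
      (((hasDerivAt_id t).add h3).const_mul (2 * (κ - 1 / κ)))
    refine this.congr_deriv ?_
    field_simp
    ring
  have hcont : ∀ s : Set ℝ, s ⊆ Set.Ici 1 → ContinuousOn f s := fun s hs t ht =>
    (hd t (hs ht)).continuousAt.continuousWithinAt
  have hfac : ∀ t : ℝ, 1 ≤ t → 0 ≤ 2 * (1 - 1 / t ^ 2) ∧ 0 ≤ 1 + 1 / (t * κ) := by
    intro t ht
    refine ⟨?_, by positivity⟩
    have : 1 / t ^ 2 ≤ 1 := by
      rw [div_le_one (by positivity)]; nlinarith
    linarith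
  rcases le_total κ ρ with h | h
  · have hm : MonotoneOn f (Set.Icc κ ρ) := by
      refine monotoneOn_of_deriv_nonneg (convex_Icc _ _) (hcont _ fun t ht => hκ.trans ht.1) ?_ ?_
      · intro t ht
        rw [interior_Icc] at ht
        exact (hd t (hκ.trans ht.1.le)).differentiableAt.differentiableWithinAt
      · intro t ht
        rw [interior_Icc] at ht
        have ht1 : 1 ≤ t := hκ.trans ht.1.le
        rw [(hd t ht1).deriv]
        exact mul_nonneg (hfac t ht1).1 (mul_nonneg (by linarith [ht.1]) (hfac t ht1).2)
    exact hm ⟨le_rfl, h⟩ ⟨h, le_rfl⟩ h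
  · have hm : AntitoneOn f (Set.Icc ρ κ) := by
      refine antitoneOn_of_deriv_nonpos (convex_Icc _ _) (hcont _ fun t ht => hρ.trans ht.1) ?_ ?_
      · intro t ht
        rw [interior_Icc] at ht
        exact (hd t (hρ.trans ht.1.le)).differentiableAt.differentiableWithinAt
      · intro t ht
        rw [interior_Icc] at ht
        have ht1 : 1 ≤ t := hρ.trans ht.1.le
        rw [(hd t ht1).deriv]
        exact mul_nonpos_of_nonneg_of_nonpos (hfac t ht1).1
          (mul_nonpos_of_nonpos_of_nonneg (by linarith [ht.2]) (hfac t ht1).2)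
    exact hm ⟨le_rfl, h⟩ ⟨h, le_rfl⟩ h

/-- With `b = a⁻¹` and `ρ = ‖b‖ > 1`, the first three terms on the right equal `moment ρ - ε(ε +
4|Im b|/ρ²)`, and `|Im b|/ρ² ≤ 1`, so the last term covers the loss. Since `|μ| ≤ ρ + 1/ρ`, the
tangent inequality for `moment` at `κ` applies. -/
theorem moment_tangent_le_semicirclePotential {ε : ℝ} (hε : 0 < ε) (μ : ℝ) {κ : ℝ} (hκ : 1 ≤ κ) :
    moment κ + 2 * (κ - 1 / κ) * (|μ| - (κ + 1 / κ))
      ≤ μ ^ 2 - 2 - 4 * semicirclePotential ε μ + 2 * ε * (ε + 2) := by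
  obtain ⟨a, ha0, ha1, ha⟩ := exists_joukowski_preimage hε.ne' μ
  rw [semicirclePotential_eq ha0 ha1 ha]
  set b : ℂ := a⁻¹ with hb
  have hb0 : b ≠ 0 := inv_ne_zero ha0
  have hab : a = b⁻¹ := by rw [hb, inv_inv]
  set ρ : ℝ := ‖b‖ with hρ
  have hρ1 : 1 < ρ := by
    rw [hρ, hb, norm_inv]
    exact (one_lt_inv₀ (norm_pos_iff.mpr ha0)).mpr ha1
  have hlog : Real.log ‖a‖ = -Real.log ρ := by
    rw [hab, norm_inv, Real.log_inv]
  have hsq : ρ ^ 2 = b.re ^ 2 + b.im ^ 2 := by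
    rw [hρ, ← Complex.normSq_eq_norm_sq, Complex.normSq_apply]; ring
  have hns : Complex.normSq b = ρ ^ 2 := Complex.normSq_eq_norm_sq b
  have hare : a.re = b.re / ρ ^ 2 := by rw [hab, Complex.inv_re, hns]
  have haim : a.im = -b.im / ρ ^ 2 := by rw [hab, Complex.inv_im, hns]
  have hμ : b.re / ρ ^ 2 + b.re = μ := by
    have := congrArg Complex.re ha
    simpa [hare] using this
  have hε' : b.im * (1 - 1 / ρ ^ 2) = -ε := by
    have := congrArg Complex.im ha
    simp [haim] at this
    rw [← this]; ring
  have hρ0 : 0 < ρ := by linarith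
  have hi : 0 < 1 / ρ ^ 2 := by positivity
  have hi1 : 1 / ρ ^ 2 < 1 := by
    rw [div_lt_one (by positivity)]; nlinarith
  have hre_le : |b.re| ≤ ρ := Complex.abs_re_le_norm b
  have him_le : |b.im| ≤ ρ := Complex.abs_im_le_norm b
  have him0 : b.im < 0 := by
    by_contra h
    nlinarith [mul_nonneg (not_lt.mp h) (by linarith : 0 ≤ 1 - 1 / ρ ^ 2)]
  have hμabs : |μ| ≤ ρ + 1 / ρ := by
    rw [← hμ, show b.re / ρ ^ 2 + b.re = b.re * (1 + 1 / ρ ^ 2) by ring, abs_mul,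
      abs_of_pos (by linarith : 0 < 1 + 1 / ρ ^ 2)]
    calc |b.re| * (1 + 1 / ρ ^ 2) ≤ ρ * (1 + 1 / ρ ^ 2) := by gcongr
      _ = ρ + 1 / ρ := by field_simp
  have hκ' : 0 ≤ κ - 1 / κ := by
    have : 1 / κ ≤ 1 := by rw [div_le_one (by linarith)]; exact hκ
    linarith
  have htan := moment_tangent_le hκ hρ1.le
  have hstep : moment κ + 2 * (κ - 1 / κ) * (|μ| - (κ + 1 / κ)) ≤ moment ρ := by
    refine le_trans ?_ htan
    gcongr
  refine hstep.trans ?_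
  have himρ : -b.im * (1 / ρ ^ 2) ≤ 1 := by
    have : -b.im ≤ ρ := by rw [← abs_of_neg him0]; exact him_le
    calc -b.im * (1 / ρ ^ 2) ≤ ρ * (1 / ρ ^ 2) := by gcongr
      _ = 1 / ρ := by field_simp
      _ ≤ 1 := by rw [div_le_one hρ0]; exact hρ1.le
  have hare2 : (a ^ 2).re = (b.re ^ 2 - b.im ^ 2) * (1 / ρ ^ 2) ^ 2 := by
    simp only [pow_two a, Complex.mul_re, hare, haim]; ring
  rw [hare2, hlog, moment, ← hμ]
  set i : ℝ := 1 / ρ ^ 2 with hidef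
  have hρi : ρ ^ 2 * i = 1 := by rw [hidef]; field_simp
  have hdiv : b.re / ρ ^ 2 = b.re * i := by rw [hidef]; ring
  rw [hdiv]
  have hx : b.re ^ 2 = ρ ^ 2 - b.im ^ 2 := by linarith
  have e1 : (b.re * i + b.re) ^ 2 = b.re ^ 2 * i ^ 2 + 2 * (b.re ^ 2 * i) + b.re ^ 2 := by ring
  rw [e1, hx]
  have hε2 : ε = -b.im * (1 - i) := by linarith
  nlinarith [mul_nonneg hε.le (by linarith : 0 ≤ 1 - -b.im * i), hρi]

/-! ### Averaging over the phase -/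

open MeasureTheory in
theorem intervalIntegral_swap_of_continuous {f : ℝ → ℝ → ℝ}
    (hf : Continuous (Function.uncurry f)) {a b c d : ℝ} (hab : a ≤ b) (hcd : c ≤ d) :
    ∫ x in a..b, ∫ y in c..d, f x y = ∫ y in c..d, ∫ x in a..b, f x y := by
  simp only [intervalIntegral.integral_of_le hab, intervalIntegral.integral_of_le hcd]
  refine integral_integral_swap ?_
  rw [Measure.prod_restrict]
  exact (hf.continuousOn.integrableOn_compact (isCompact_Icc.prod isCompact_Icc)).mono_set
    (Set.prod_mono Set.Ioc_subset_Icc_self Set.Ioc_subset_Icc_self)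

theorem circleAverage_swap {f : ℂ → ℂ → ℝ}
    (hf : Continuous fun p : ℝ × ℝ => f (circleMap 0 1 p.1) (circleMap 0 1 p.2)) :
    Real.circleAverage (fun w => Real.circleAverage (fun z => f w z) 0 1) 0 1
      = Real.circleAverage (fun z => Real.circleAverage (fun w => f w z) 0 1) 0 1 := by
  simp only [Real.circleAverage, intervalIntegral.integral_smul]
  rw [intervalIntegral_swap_of_continuous (f := fun x y => f (circleMap 0 1 x) (circleMap 0 1 y))
    hf Real.two_pi_pos.le Real.two_pi_pos.le]

open MeasureTheory in
theorem exists_circleAverage_le {g : ℂ → ℝ} (hg : CircleIntegrable g 0 1) :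
    ∃ w : ℂ, ‖w‖ = 1 ∧ Real.circleAverage g 0 1 ≤ g w := by
  have hg' := hg.1
  obtain ⟨θ, -, hθ⟩ := exists_setAverage_le (μ := volume) (s := Set.Ioc 0 (2 * Real.pi))
    (f := fun θ => g (circleMap 0 1 θ)) (by simp [Real.pi_pos])
    measure_Ioc_lt_top.ne hg'
  refine ⟨circleMap 0 1 θ, by simp, ?_⟩
  rwa [Real.circleAverage_eq_intervalAverage, Set.uIoc_of_le Real.two_pi_pos.le]

/-- The weight has mean `1`, so after exchanging the averages the mean over `ω` is at least `c`;
some `ω` does at least as well as the mean. -/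
theorem exists_le_circleAverage_of_weight {f : ℂ → ℂ → ℝ} {c : ℝ}
    (hcont : Continuous (Function.uncurry f))
    (hf : ∀ z : ℂ, ‖z‖ = 1 → c * (1 - (z ^ 2).re) ≤ Real.circleAverage (fun ω => f ω z) 0 1) :
    ∃ ω : ℂ, ‖ω‖ = 1 ∧ c ≤ Real.circleAverage (f ω) 0 1 := by
  have hcont' : Continuous fun p : ℝ × ℝ => f (circleMap 0 1 p.1) (circleMap 0 1 p.2) :=
    hcont.comp (((continuous_circleMap 0 1).comp continuous_fst).prodMk
      ((continuous_circleMap 0 1).comp continuous_snd))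
  have hint : CircleIntegrable (fun ω => Real.circleAverage (fun z => f ω z) 0 1) 0 1 := by
    have : Continuous fun φ : ℝ => Real.circleAverage (fun z => f (circleMap 0 1 φ) z) 0 1 := by
      unfold Real.circleAverage
      exact (intervalIntegral.continuous_parametric_intervalIntegral_of_continuous'
        (μ := MeasureTheory.volume)
        (f := fun x y => f (circleMap 0 1 x) (circleMap 0 1 y)) hcont' 0 (2 * Real.pi)).const_smul
        (2 * Real.pi)⁻¹
    exact this.intervalIntegrable _ _
  obtain ⟨ω, hω, hle⟩ := exists_circleAverage_le hint
  refine ⟨ω, hω, le_trans ?_ hle⟩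
  rw [circleAverage_swap hcont']
  have hc := congrArg (c * ·) circleAverage_weight
  simp only [mul_one] at hc
  rw [← hc, ← smul_eq_mul, ← Real.circleAverage_fun_smul]
  refine Real.circleAverage_mono (ContinuousOn.circleIntegrable zero_le_one (by fun_prop)) ?_ ?_
  · have : Continuous fun θ : ℝ => Real.circleAverage (fun w => f w (circleMap 0 1 θ)) 0 1 := by
      unfold Real.circleAverage
      exact (intervalIntegral.continuous_parametric_intervalIntegral_of_continuous'
        (μ := MeasureTheory.volume)
        (f := fun y x => f (circleMap 0 1 x) (circleMap 0 1 y))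
        (hcont'.comp continuous_swap) 0 (2 * Real.pi)).const_smul (2 * Real.pi)⁻¹
    exact this.intervalIntegrable _ _
  · intro z hz
    exact hf z (by simpa using hz)

/-! ### Twisted Hermitian matrices and Jensen's inequality -/

namespace Matrix

variable {ι : Type*}

/-- The Hermitian matrix `ω X + ω̄ X* + D`. -/
def twist (X D : Matrix ι ι ℂ) (ω : ℂ) : Matrix ι ι ℂ := ω • X + star ω • Xᴴ + D

theorem twist_isHermitian (X : Matrix ι ι ℂ) {D : Matrix ι ι ℂ} (hD : D.IsHermitian) (ω : ℂ) :
    (twist X D ω).IsHermitian := by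
  unfold IsHermitian twist
  rw [conjTranspose_add, conjTranspose_add, conjTranspose_smul, conjTranspose_smul,
    conjTranspose_conjTranspose, star_star, hD.eq, add_comm (star ω • Xᴴ)]

variable [Fintype ι] [DecidableEq ι]

/-- Jensen's inequality for the Laurent polynomial `ω ↦ det (ω X + ω̄ X* + D - x)` on the unit
circle. -/
theorem log_norm_det_le_circleAverage_twist {X D : Matrix ι ι ℂ} (hX : X.det ≠ 0) (x : ℂ) :
    Real.log ‖X.det‖
      ≤ Real.circleAverage (fun ω => Real.log ‖(twist X D ω - x • (1 : Matrix ι ι ℂ)).det‖) 0 1 := by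
  -- Multiplying by `ω` clears `ω̄ = ω⁻¹` on the circle. The constant coefficient of `det P` is `det
  -- X*`, and the Mahler measure dominates its modulus.
  set P : Matrix ι ι (Polynomial ℂ) := (Polynomial.X ^ 2 : Polynomial ℂ) • X.map Polynomial.C
    + Xᴴ.map Polynomial.C + (Polynomial.X : Polynomial ℂ) •
      (D - x • (1 : Matrix ι ι ℂ)).map Polynomial.C with hP
  have heval : ∀ ω : ℂ, P.det.eval ω
      = (ω ^ 2 • X + Xᴴ + ω • (D - x • (1 : Matrix ι ι ℂ))).det := by
    intro ω
    rw [← Polynomial.coe_evalRingHom, RingHom.map_det]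
    congr 1
    ext i j
    simp [hP]
    exact mul_comm _ _
  have h0 : ‖P.det.coeff 0‖ = ‖X.det‖ := by
    rw [Polynomial.coeff_zero_eq_eval_zero, heval]
    simp [det_conjTranspose]
  have hle := Polynomial.norm_coeff_le_choose_mul_mahlerMeasure 0 P.det
  rw [h0, Nat.choose_zero_right, Nat.cast_one, one_mul] at hle
  have hlog := Real.log_le_log (norm_pos_iff.mpr hX) hle
  rw [← Polynomial.logMahlerMeasure_eq_log_MahlerMeasure, Polynomial.logMahlerMeasure_def] at hlog
  refine hlog.trans (le_of_eq (Real.circleAverage_congr_sphere fun ω hω => ?_))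
  have hω1 : ‖ω‖ = 1 := by simpa using hω
  have hωs : ω * star ω = 1 := by
    rw [Complex.star_def, Complex.mul_conj, Complex.normSq_eq_norm_sq, hω1]; simp
  have e : ω ^ 2 • X + Xᴴ + ω • (D - x • (1 : Matrix ι ι ℂ))
      = ω • (twist X D ω - x • (1 : Matrix ι ι ℂ)) := by
    rw [twist, add_sub_assoc, smul_add, smul_add, smul_smul, smul_smul, hωs, one_smul, pow_two]
  simp only [heval]
  rw [e, det_smul, norm_mul, norm_pow, hω1, one_pow, one_mul]

theorem IsHermitian.det_sub_smul_one {M : Matrix ι ι ℂ} (hM : M.IsHermitian) (x : ℂ) :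
    (M - x • (1 : Matrix ι ι ℂ)).det = ∏ j, ((hM.eigenvalues j : ℂ) - x) := by
  have h := congrArg (Polynomial.eval x) hM.charpoly_eq
  rw [eval_charpoly, Polynomial.eval_prod] at h
  rw [← neg_sub, det_neg, show x • (1 : Matrix ι ι ℂ) = scalar ι x from smul_one_eq_diagonal x, h,
    ← Finset.card_univ, ← Finset.prod_const, ← Finset.prod_mul_distrib]
  simp

/-- Jensen's lower bound does not depend on `x`, so it survives averaging `x` over the shifted
semicircle law. As `ε ≠ 0`, `x` avoids the real spectrum and the logarithm is continuous in `(ω,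
z)`. -/
theorem exists_twist_log_norm_det_le {X D : Matrix ι ι ℂ} (hX : X.det ≠ 0) (hD : D.IsHermitian)
    {ε : ℝ} (hε : ε ≠ 0) :
    ∃ ω : ℂ, ‖ω‖ = 1 ∧ Real.log ‖X.det‖
      ≤ ∑ j, semicirclePotential ε ((twist_isHermitian X hD ω).eigenvalues j) := by
  set x : ℂ → ℂ := fun z => ((2 * z.re : ℝ) : ℂ) + ε * Complex.I with hx
  have hxc : Continuous x := by fun_prop
  have hfac : ∀ (μ : ℝ) (z : ℂ), (μ : ℂ) - x z ≠ 0 := by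
    intro μ z h
    have := congrArg Complex.im h
    simp [hx] at this
    exact hε this
  set f : ℂ → ℂ → ℝ := fun ω z =>
    (1 - (z ^ 2).re) * Real.log ‖(twist X D ω - x z • (1 : Matrix ι ι ℂ)).det‖ with hf
  have hdet : ∀ ω z, (twist X D ω - x z • (1 : Matrix ι ι ℂ)).det ≠ 0 := by
    intro ω z
    rw [(twist_isHermitian X hD ω).det_sub_smul_one]
    exact Finset.prod_ne_zero_iff.mpr fun j _ => hfac _ _
  have hcont : Continuous (Function.uncurry f) := by
    refine Continuous.mul (by fun_prop) (Continuous.log ?_ fun p => norm_ne_zero_iff.mpr (hdet _ _))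
    refine (Continuous.matrix_det ?_).norm
    unfold twist
    fun_prop
  have hpot : ∀ ω, Real.circleAverage (fun z => f ω z) 0 1
      = ∑ j, semicirclePotential ε ((twist_isHermitian X hD ω).eigenvalues j) := by
    intro ω
    simp only [semicirclePotential]
    rw [← Real.circleAverage_fun_sum]
    · congr 1
      funext z
      simp only [hf]
      rw [(twist_isHermitian X hD ω).det_sub_smul_one, norm_prod,
        Real.log_prod fun j _ => norm_ne_zero_iff.mpr (hfac _ _), Finset.mul_sum]
    · intro j _
      refine ContinuousOn.circleIntegrable zero_le_one (ContinuousOn.mul (by fun_prop) ?_)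
      exact ContinuousOn.log (by fun_prop) fun z _ => norm_ne_zero_iff.mpr (hfac _ z)
  simp only [← hpot]
  refine exists_le_circleAverage_of_weight hcont fun z hz1 => ?_
  have hw : 0 ≤ 1 - (z ^ 2).re := by
    have := (abs_le.mp (Complex.abs_re_le_norm (z ^ 2))).2
    rw [norm_pow, hz1, one_pow] at this
    linarith
  have := Real.circleAverage_fun_smul (a := 1 - (z ^ 2).re) (c := 0) (R := 1)
    (f := fun ω => Real.log ‖(twist X D ω - x z • (1 : Matrix ι ι ℂ)).det‖)
  simp only [smul_eq_mul] at this
  rw [hf, this, mul_comm]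
  exact mul_le_mul_of_nonneg_left (log_norm_det_le_circleAverage_twist hX (x z)) hw

theorem IsHermitian.sum_eigenvalues_sq {M : Matrix ι ι ℂ} (hM : M.IsHermitian) :
    ((∑ j, hM.eigenvalues j ^ 2 : ℝ) : ℂ) = (M * M).trace := by
  conv_rhs => rw [hM.spectral_theorem]
  rw [← map_mul, Unitary.conjStarAlgAut_apply, trace_mul_cycle, Unitary.coe_star_mul_self, one_mul,
    diagonal_mul_diagonal, trace_diagonal]
  simp [pow_two]

theorem IsHermitian.sum_eigenvalues_mul_norm_inner_sq {M : Matrix ι ι ℂ} (hM : M.IsHermitian)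
    (v : EuclideanSpace ℂ ι) :
    ∑ j, hM.eigenvalues j * ‖inner ℂ (hM.eigenvectorBasis j) v‖ ^ 2
      = (inner ℂ v (toEuclideanCLM (n := ι) (𝕜 := ℂ) M v)).re := by
  rw [← hM.eigenvectorBasis.sum_inner_mul_inner, Complex.re_sum]
  refine Finset.sum_congr rfl fun j _ => ?_
  have h1 : toEuclideanCLM (n := ι) (𝕜 := ℂ) M (hM.eigenvectorBasis j)
      = (hM.eigenvalues j : ℂ) • hM.eigenvectorBasis j := by
    ext i
    have := congrFun (hM.mulVec_eigenvectorBasis j) i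
    simpa using this
  have h2 : inner ℂ (hM.eigenvectorBasis j) (toEuclideanCLM (n := ι) (𝕜 := ℂ) M v)
      = (hM.eigenvalues j : ℂ) * inner ℂ (hM.eigenvectorBasis j) v := by
    have hadj : ContinuousLinearMap.adjoint (toEuclideanCLM (n := ι) (𝕜 := ℂ) M)
        = toEuclideanCLM (n := ι) (𝕜 := ℂ) M := by
      rw [← ContinuousLinearMap.star_eq_adjoint, ← map_star, star_eq_conjTranspose, hM.eq]
    rw [← ContinuousLinearMap.adjoint_inner_left, hadj, h1, inner_smul_left, Complex.conj_ofReal]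
  rw [h2, ← inner_conj_symm v, mul_left_comm, ← Complex.normSq_eq_conj_mul_self,
    Complex.normSq_eq_norm_sq, ← Complex.ofReal_mul, Complex.ofReal_re]

/-- Every product whose phase does not cancel has trace zero, so the result is independent of `ω`.
-/
theorem trace_twist_mul_self {ι : Type*} [Fintype ι] (X D : Matrix ι ι ℂ) {ω : ℂ} (hω : ‖ω‖ = 1)
    (hXX : (X * X).trace = 0) (hXD : (X * D).trace = 0) (hD : D.IsHermitian) :
    (twist X D ω * twist X D ω).trace = (D * D).trace + 2 * (X * Xᴴ).trace := by
  have hωs : ω * star ω = 1 := by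
    rw [Complex.star_def, Complex.mul_conj, Complex.normSq_eq_norm_sq, hω]; simp
  have h1 : (Xᴴ * Xᴴ).trace = 0 := by
    rw [← conjTranspose_mul, trace_conjTranspose, hXX, star_zero]
  have h2 : (D * Xᴴ).trace = 0 := by
    rw [← hD.eq, ← conjTranspose_mul, trace_conjTranspose, hXD, star_zero]
  have h3 : (D * X).trace = 0 := by rw [trace_mul_comm, hXD]
  have h4 : (Xᴴ * D).trace = 0 := by rw [trace_mul_comm, h2]
  have h5 : (Xᴴ * X).trace = (X * Xᴴ).trace := trace_mul_comm _ _
  simp only [twist, Matrix.add_mul, Matrix.mul_add, Matrix.smul_mul, Matrix.mul_smul, trace_add, trace_smul,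
    hXX, hXD, h1, h2, h3, h4, h5, smul_eq_mul]
  linear_combination (2 * (X * Xᴴ).trace) * hωs

end Matrix

/-! ### Self-adjointness and the bound on multiplicities -/

theorem inner_matOp_left {m : ℕ} (M : Matrix (Fin m) (Fin m) ℂ) (x y : EuclideanSpace ℂ (Fin m)) :
    inner ℂ (matOp M x) y = inner ℂ x (matOp Mᴴ y) := by
  have h : matOp Mᴴ = ContinuousLinearMap.adjoint (matOp M) := by
    rw [← ContinuousLinearMap.star_eq_adjoint]
    exact map_star (Matrix.toEuclideanCLM (n := Fin m) (𝕜 := ℂ)) M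
  rw [h, ContinuousLinearMap.adjoint_inner_right]

theorem matOp_eq_zero_iff {m : ℕ} {M : Matrix (Fin m) (Fin m) ℂ} (hM : IsUnit M)
    {x : EuclideanSpace ℂ (Fin m)} : matOp M x = 0 ↔ x = 0 := by
  refine ⟨fun h => ?_, fun h => by rw [h, map_zero]⟩
  have h1 : matOp (M⁻¹ * M) x = 0 := by
    rw [matOp, map_mul, mul_apply_eq_comp, h, map_zero]
  rwa [Matrix.nonsing_inv_mul M ((Matrix.isUnit_iff_isUnit_det M).mp hM), matOp, map_one] at h1

theorem inner_weightedShift_left {m : ℕ} {T T' : ℤ → Matrix (Fin m) (Fin m) ℂ}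
    (hT : ∃ C : ℝ, ∀ n, ‖matOp (T n)‖ ≤ C) (hT' : ∃ C : ℝ, ∀ n, ‖matOp (T' n)‖ ≤ C) {s s' : ℤ}
    (hs : s' = -s) (h : ∀ n, T' (n + s) = (T n)ᴴ) (u v : SeqSpace m) :
    inner ℂ (weightedShift T hT s u) v = inner ℂ u (weightedShift T' hT' s' v) := by
  rw [lp.inner_eq_tsum, lp.inner_eq_tsum, ← (Equiv.addRight s).tsum_eq
    fun n => inner ℂ (u n) (weightedShift T' hT' s' v n)]
  refine tsum_congr fun n => ?_
  change inner ℂ (matOp (T n) (u (n + s))) (v n)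
    = inner ℂ (u (n + s)) (matOp (T' (n + s)) (v (n + s + s')))
  rw [h, hs, add_neg_cancel_right, inner_matOp_left]

theorem tendsto_apply_cofinite_zero {m : ℕ} (u : SeqSpace m) :
    Tendsto (fun n => ‖u n‖) cofinite (𝓝 0) := by
  have h := (lp.hasSum_norm (by norm_num) u).summable.tendsto_cofinite_zero
  have h2 := h.rpow_const (p := (1 / 2 : ℝ)) (Or.inr (by norm_num))
  rw [Real.zero_rpow (by norm_num)] at h2
  refine h2.congr fun n => ?_
  rw [← Real.rpow_mul (norm_nonneg _)]
  norm_num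

namespace MatrixJacobi

variable {m : ℕ} (J : MatrixJacobi m)

theorem inner_W_left (u v : SeqSpace m) : inner ℂ (J.W u) v = inner ℂ u (J.W v) := by
  unfold W
  simp only [add_apply, inner_add_left, inner_add_right]
  rw [inner_weightedShift_left J.bounded_A_conjTranspose J.bounded_A (s' := 1) (by norm_num)
      (fun n => by rw [Matrix.conjTranspose_conjTranspose, ← sub_eq_add_neg]),
    inner_weightedShift_left J.bounded_A J.bounded_A_conjTranspose (s' := -1) rfl
      (fun n => by rw [add_sub_cancel_right]),
    inner_weightedShift_left J.bounded_B J.bounded_B (s' := 0) (by norm_num)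
      (fun n => by rw [add_zero, (J.isHermitian_B n).eq]), add_comm (inner ℂ u _)]

theorem isSelfAdjoint_W : IsSelfAdjoint J.W :=
  ContinuousLinearMap.isSelfAdjoint_iff_isSymmetric.mpr fun u v => J.inner_W_left u v

theorem mem_eigenspace_iff {lam : ℝ} {u : SeqSpace m} :
    u ∈ J.eigenspace lam ↔ J.W u = (lam : ℂ) • u :=
  Module.End.mem_eigenspace_iff

theorem eigenspace_apply {lam : ℝ} {u : SeqSpace m} (hu : u ∈ J.eigenspace lam) (n : ℤ) :
    matOp (J.A (n - 1))ᴴ (u (n - 1)) + matOp (J.A n) (u (n + 1)) + matOp (J.B n) (u n)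
      = (lam : ℂ) • u n := by
  rw [← W_apply, J.mem_eigenspace_iff.mp hu]
  rfl

/-- The imaginary part of `⟨u(n), A(n) u(n + 1)⟩` vanishes for eigenvectors with real
eigenvalue. -/
theorem inner_A_im_eq_zero {lam : ℝ} {u : SeqSpace m} (hu : u ∈ J.eigenspace lam) (n : ℤ) :
    (inner ℂ (u n) (matOp (J.A n) (u (n + 1)))).im = 0 := by
  set q : ℤ → ℝ := fun n => (inner ℂ (u n) (matOp (J.A n) (u (n + 1)))).im with hq
  -- Pair the eigenvalue equation with `u n`: the `B` and `lam` terms are real, so the current `q`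
  -- is conserved. It must vanish, because it tends to `0` at infinity.
  have hstep : ∀ n, q (n - 1) = q n := by
    intro n
    have h := congrArg (fun x => (inner ℂ (u n) x).im) (J.eigenspace_apply hu n)
    simp only [inner_add_right, inner_smul_right, Complex.add_im] at h
    have h1 : ((lam : ℂ) * inner ℂ (u n) (u n)).im = 0 := by
      rw [Complex.im_ofReal_mul, show (inner ℂ (u n) (u n)).im = 0 from inner_self_im (𝕜 := ℂ) (u n),
        mul_zero]
    have h2 : (inner ℂ (u n) (matOp (J.B n) (u n))).im = 0 := by
      have := inner_matOp_left (J.B n) (u n) (u n)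
      rw [(J.isHermitian_B n).eq, ← inner_conj_symm] at this
      exact Complex.conj_eq_iff_im.mp this
    have h3 : (inner ℂ (u n) (matOp (J.A (n - 1))ᴴ (u (n - 1)))).im = -q (n - 1) := by
      rw [← inner_matOp_left, ← inner_conj_symm, Complex.conj_im, hq]
      simp
    rw [h1, h2, h3] at h
    simp only [hq] at h ⊢
    linarith
  have hconst : ∀ n, q n = q 0 := by
    intro n
    induction n using Int.induction_on with
    | zero => rfl
    | succ i ih => rw [← ih, ← hstep, add_sub_cancel_right]
    | pred i ih => rw [← ih, hstep]
  obtain ⟨C, hC⟩ := J.bounded_A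
  have hlim : Tendsto q cofinite (𝓝 0) := by
    have hsh : Tendsto (fun n : ℤ => ‖u (n + 1)‖) cofinite (𝓝 0) :=
      (tendsto_apply_cofinite_zero u).comp (Equiv.addRight (1 : ℤ)).injective.tendsto_cofinite
    have hb : Tendsto (fun n : ℤ => ‖u n‖ * (C * ‖u (n + 1)‖)) cofinite (𝓝 0) := by
      simpa using (tendsto_apply_cofinite_zero u).mul (hsh.const_mul C)
    refine squeeze_zero_norm (fun n => ?_) hb
    calc ‖q n‖ ≤ ‖inner ℂ (u n) (matOp (J.A n) (u (n + 1)))‖ := Complex.abs_im_le_norm _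
      _ ≤ ‖u n‖ * ‖matOp (J.A n) (u (n + 1))‖ := norm_inner_le_norm _ _
      _ ≤ ‖u n‖ * (C * ‖u (n + 1)‖) := by
        gcongr
        exact (matOp (J.A n)).le_of_opNorm_le (hC n) _
  have h0 : q 0 = 0 := tendsto_nhds_unique
    (tendsto_const_nhds.congr fun n => (hconst n).symm) hlim
  rw [← h0, ← hconst n]

/-- The recurrence, solved in either direction with `A` invertible, propagates two adjacent zeros.
-/
theorem eigenvector_eq_zero {lam : ℝ} {u : SeqSpace m} (hu : u ∈ J.eigenspace lam)
    (h0 : u 0 = 0) (h1 : u 1 = 0) : u = 0 := by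
  have key : ∀ n : ℤ, u n = 0 ∧ u (n + 1) = 0 := by
    intro n
    induction n using Int.induction_on with
    | zero => exact ⟨h0, by simpa using h1⟩
    | succ i ih =>
      refine ⟨ih.2, ?_⟩
      have h := J.eigenspace_apply hu (i + 1)
      rw [add_sub_cancel_right, ih.1, ih.2, map_zero, map_zero, zero_add, add_zero, smul_zero] at h
      exact (matOp_eq_zero_iff (J.isUnit_A _)).mp h
    | pred i ih =>
      refine ⟨?_, by rw [sub_add_cancel]; exact ih.1⟩
      have h := J.eigenspace_apply hu (-i)
      rw [ih.1, ih.2, map_zero, map_zero, add_zero, add_zero, smul_zero] at h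
      exact (matOp_eq_zero_iff (J.isUnit_A _).star).mp h
  ext1
  funext n
  exact (key n).1

/-- The boundary data `u ↦ u(0) + i A(0) u(1)`. -/
def boundaryMap : SeqSpace m →ₗ[ℂ] EuclideanSpace ℂ (Fin m) where
  toFun u := u 0 + Complex.I • matOp (J.A 0) (u 1)
  map_add' u v := by
    simp only [lp.coeFn_add, Pi.add_apply, map_add, smul_add]
    abel
  map_smul' c u := by
    simp only [lp.coeFn_smul, Pi.smul_apply, map_smul, smul_add, RingHom.id_apply]
    rw [smul_comm]

theorem boundaryMap_domRestrict_injective (lam : ℝ) :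
    Function.Injective (J.boundaryMap.domRestrict (J.eigenspace lam)) := by
  rw [← LinearMap.ker_eq_bot, LinearMap.ker_eq_bot']
  rintro ⟨u, hu⟩ h
  have h : u 0 + Complex.I • matOp (J.A 0) (u 1) = 0 := h
  have him := J.inner_A_im_eq_zero hu 0
  -- On the kernel `u 0 = -i A(0) u(1)`, so the current is `‖A(0) u(1)‖²`; its vanishing forces `u 1
  -- = 0`.
  rw [zero_add, eq_neg_of_add_eq_zero_left h, ← neg_smul, inner_smul_left,
    inner_self_eq_norm_sq_to_K] at him
  simp at him
  have h1 : u 1 = 0 := (matOp_eq_zero_iff (J.isUnit_A 0)).mp ?_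
  · rw [h1, map_zero, smul_zero, add_zero] at h
    exact Subtype.ext (J.eigenvector_eq_zero hu h h1)
  · rw [← Complex.ofReal_pow, Complex.ofReal_re] at him
    simpa using him

theorem finiteDimensional_eigenspace (lam : ℝ) : FiniteDimensional ℂ (J.eigenspace lam) :=
  Module.Finite.of_injective _ (J.boundaryMap_domRestrict_injective lam)

theorem multiplicity_le (lam : ℝ) : J.multiplicity lam ≤ m := by
  have := LinearMap.finrank_le_finrank_of_injective (J.boundaryMap_domRestrict_injective lam)
  rwa [finrank_euclideanSpace_fin] at this

end MatrixJacobi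

/-! ### Block shifts on a ring -/

namespace Matrix

variable {m l : ℕ}

/-- The block matrix on a ring of `l + 1` sites with block `A i` from site `i + 1` to site `i`. -/
def ringShift (A : Fin (l + 1) → Matrix (Fin m) (Fin m) ℂ) :
    Matrix (Fin m × Fin (l + 1)) (Fin m × Fin (l + 1)) ℂ :=
  (blockDiagonal A).submatrix id (Equiv.prodCongr (Equiv.refl (Fin m)) (Equiv.subRight 1))

theorem ringShift_apply (A : Fin (l + 1) → Matrix (Fin m) (Fin m) ℂ) (p q : Fin m × Fin (l + 1)) :
    ringShift A p q = if p.2 = q.2 - 1 then A p.2 p.1 q.1 else 0 := by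
  simp [ringShift, blockDiagonal_apply]

/-- The shift is a block diagonal matrix with permuted columns; the sign of the permutation has
modulus one. -/
theorem norm_det_ringShift (A : Fin (l + 1) → Matrix (Fin m) (Fin m) ℂ) :
    ‖(ringShift A).det‖ = ∏ i, ‖(A i).det‖ := by
  rw [ringShift, det_permute', det_blockDiagonal, norm_mul, norm_prod]
  have : ∀ s : ℤˣ, ‖((s : ℤ) : ℂ)‖ = 1 := by
    intro s
    rcases Int.units_eq_one_or s with rfl | rfl <;> simp
  rw [this, one_mul]

theorem ringShift_mul_conjTranspose (A : Fin (l + 1) → Matrix (Fin m) (Fin m) ℂ) :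
    ringShift A * (ringShift A)ᴴ = blockDiagonal fun i => A i * (A i)ᴴ := by
  rw [ringShift, conjTranspose_submatrix, submatrix_mul_equiv, blockDiagonal_conjTranspose,
    ← blockDiagonal_mul, submatrix_id_id]

/-- Two steps around a ring of at least three sites never return to the start; on two sites they
would. -/
theorem trace_ringShift_mul_self (hl : 2 ≤ l) (A : Fin (l + 1) → Matrix (Fin m) (Fin m) ℂ) :
    (ringShift A * ringShift A).trace = 0 := by
  simp only [trace, diag, mul_apply]
  refine Finset.sum_eq_zero fun p _ => Finset.sum_eq_zero fun q _ => ?_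
  rw [ringShift_apply, ringShift_apply]
  split_ifs with h1 h2
  · exfalso
    have e : (1 + 1 : Fin (l + 1)) = 0 := by
      have : q.2 = q.2 - 1 - 1 := by rw [← h1]; exact h2
      rw [sub_sub, eq_comm, sub_eq_self] at this
      exact this
    have := congrArg Fin.val e
    rw [Fin.val_add, Fin.val_one', Fin.val_zero] at this
    rw [Nat.mod_eq_of_lt (by omega : 1 < l + 1), Nat.mod_eq_of_lt (by omega)] at this
    omega
  all_goals simp

theorem trace_ringShift_mul_blockDiagonal (hl : 2 ≤ l)
    (A B : Fin (l + 1) → Matrix (Fin m) (Fin m) ℂ) :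
    (ringShift A * blockDiagonal B).trace = 0 := by
  simp only [trace, diag, mul_apply]
  refine Finset.sum_eq_zero fun p _ => Finset.sum_eq_zero fun q _ => ?_
  rw [ringShift_apply, blockDiagonal_apply]
  split_ifs with h1 h2
  · exfalso
    rw [← h2, eq_comm, sub_eq_self] at h1
    have := congrArg Fin.val h1
    rw [Fin.val_one', Fin.val_zero, Nat.mod_eq_of_lt (by omega : 1 < l + 1)] at this
    omega
  all_goals simp

/-- The component at the site `j` of a vector on the ring. -/
def slice (v : EuclideanSpace ℂ (Fin m × Fin (l + 1))) (j : Fin (l + 1)) :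
    EuclideanSpace ℂ (Fin m) := WithLp.toLp 2 fun a => v (a, j)

theorem inner_eq_sum_inner_slice (v w : EuclideanSpace ℂ (Fin m × Fin (l + 1))) :
    inner ℂ v w = ∑ j, inner ℂ (slice v j) (slice w j) := by
  simp [PiLp.inner_apply, Fintype.sum_prod_type_right, slice]

theorem norm_sq_eq_sum_norm_slice_sq (v : EuclideanSpace ℂ (Fin m × Fin (l + 1))) :
    ‖v‖ ^ 2 = ∑ j, ‖slice v j‖ ^ 2 := by
  simp [EuclideanSpace.norm_sq_eq, Fintype.sum_prod_type_right, slice]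

theorem slice_toEuclideanCLM_twist (A B : Fin (l + 1) → Matrix (Fin m) (Fin m) ℂ) (ω : ℂ)
    (v : EuclideanSpace ℂ (Fin m × Fin (l + 1))) (j : Fin (l + 1)) :
    slice (toEuclideanCLM (n := Fin m × Fin (l + 1)) (𝕜 := ℂ)
        (twist (ringShift A) (blockDiagonal B) ω) v) j
      = ω • matOp (A j) (slice v (j + 1)) + star ω • matOp (A (j - 1))ᴴ (slice v (j - 1))
        + matOp (B j) (slice v j) := by
  have h1 : ∀ i k : Fin (l + 1), i = k - 1 ↔ k = i + 1 := fun i k => by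
    rw [eq_sub_iff_add_eq, eq_comm]
  ext a
  simp only [slice, ofLp_toEuclideanCLM, mulVec, dotProduct, twist, add_apply, smul_apply,
    conjTranspose_apply, ringShift_apply, blockDiagonal_apply, Fintype.sum_prod_type, PiLp.add_apply,
    PiLp.smul_apply, smul_eq_mul, add_mul, Finset.sum_add_distrib, h1]
  congr 1
  · congr 1
    · simp [Finset.mul_sum, mul_assoc]
    · have : ∀ x : Fin (l + 1), (j = x + 1) ↔ x = j - 1 := fun x => by
        rw [eq_sub_iff_add_eq, eq_comm]
      simp [Finset.mul_sum, mul_assoc, this, apply_ite (starRingEnd ℂ)]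
  · simp

end Matrix

/-! ### The trace inequality for twisted matrices -/

namespace Matrix

variable {ι κ : Type*} [Fintype ι] [DecidableEq ι] [Fintype κ]

/-- A trace inequality of Jensen type: if affine functions lie below `g` on the spectrum of `M`,
then their sum over a Bessel family is at most the sum of `g`. -/
theorem IsHermitian.sum_affine_le_sum {M : Matrix ι ι ℂ} (hM : M.IsHermitian)
    {v : κ → EuclideanSpace ℂ ι}
    (hv : ∀ e : EuclideanSpace ℂ ι, ∑ i, ‖inner ℂ e (v i)‖ ^ 2 ≤ ‖e‖ ^ 2)
    {g : ι → ℝ} (hg : ∀ j, 0 ≤ g j) {α β : κ → ℝ}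
    (h : ∀ i j, α i + β i * hM.eigenvalues j ≤ g j) :
    ∑ i, (α i * ‖v i‖ ^ 2 + β i * (inner ℂ (v i) (toEuclideanCLM (n := ι) (𝕜 := ℂ) M (v i))).re)
      ≤ ∑ j, g j := by
  set w : κ → ι → ℝ := fun i j => ‖inner ℂ (hM.eigenvectorBasis j) (v i)‖ ^ 2 with hw
  have hw0 : ∀ i j, 0 ≤ w i j := fun i j => sq_nonneg _
  calc _ = ∑ i, ∑ j, w i j * (α i + β i * hM.eigenvalues j) := by
        refine Finset.sum_congr rfl fun i _ => ?_
        rw [← hM.sum_eigenvalues_mul_norm_inner_sq, ← hM.eigenvectorBasis.sum_sq_norm_inner_right,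
          Finset.mul_sum, Finset.mul_sum, ← Finset.sum_add_distrib]
        refine Finset.sum_congr rfl fun j _ => ?_
        simp only [hw]
        ring
    _ ≤ ∑ i, ∑ j, w i j * g j := Finset.sum_le_sum fun i _ => Finset.sum_le_sum fun j _ =>
        mul_le_mul_of_nonneg_left (h i j) (hw0 i j)
    _ = ∑ j, (∑ i, w i j) * g j := by
        rw [Finset.sum_comm]
        exact Finset.sum_congr rfl fun j _ => (Finset.sum_mul _ _ _).symm
    _ ≤ ∑ j, g j := by
        refine Finset.sum_le_sum fun j _ => mul_le_of_le_one_left (hg j) ?_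
        have := hv (hM.eigenvectorBasis j)
        rwa [hM.eigenvectorBasis.orthonormal.1 j, one_pow] at this

/-- The phase is fixed before the vectors are chosen, because the truncated eigenvectors to be
inserted depend on `ω`. -/
theorem exists_twist_sum_moment_le {X D : Matrix ι ι ℂ} (hX : X.det ≠ 0) (hD : D.IsHermitian)
    (hXX : (X * X).trace = 0) (hXD : (X * D).trace = 0) {ε : ℝ} (hε : 0 < ε) :
    ∃ ω : ℂ, ‖ω‖ = 1 ∧ ∀ (v : κ → EuclideanSpace ℂ ι) (k σ : κ → ℝ),
      (∀ e : EuclideanSpace ℂ ι, ∑ i, ‖inner ℂ e (v i)‖ ^ 2 ≤ ‖e‖ ^ 2) →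
      (∀ i, 1 ≤ k i) → (∀ i, |σ i| = 1) →
      ∑ i, ((moment (k i) - 2 * (k i - 1 / k i) * (k i + 1 / k i)) * ‖v i‖ ^ 2
        + 2 * (k i - 1 / k i) * σ i *
          (inner ℂ (v i) (toEuclideanCLM (n := ι) (𝕜 := ℂ) (twist X D ω) (v i))).re)
      ≤ (D * D).trace.re + 2 * (X * Xᴴ).trace.re - 2 * Fintype.card ι - 4 * Real.log ‖X.det‖
        + Fintype.card ι * (2 * ε * (ε + 2)) := by
  obtain ⟨ω, hω, hle⟩ := exists_twist_log_norm_det_le hX hD hε.ne'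
  refine ⟨ω, hω, fun v k σ hv hk hσ => ?_⟩
  have hM := twist_isHermitian X hD ω
  set g : ι → ℝ := fun j => hM.eigenvalues j ^ 2 - 2 - 4 * semicirclePotential ε (hM.eigenvalues j)
    + 2 * ε * (ε + 2) with hg
  -- The tangent at `κ = 1` is the zero function.
  have hg0 : ∀ j, 0 ≤ g j := fun j => by
    have := moment_tangent_le_semicirclePotential hε (hM.eigenvalues j) le_rfl
    simpa [moment] using this
  -- The sign `σ i` turns the tangent in `|μ|` into an affine minorant in `μ`, as its slope is
  -- nonnegative; this treats eigenvalues above `2` and below `-2` alike.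
  have hlin : ∀ i j, (moment (k i) - 2 * (k i - 1 / k i) * (k i + 1 / k i))
      + 2 * (k i - 1 / k i) * σ i * hM.eigenvalues j ≤ g j := fun i j => by
    refine le_trans ?_ (moment_tangent_le_semicirclePotential hε (hM.eigenvalues j) (hk i))
    have hk' : 0 ≤ k i - 1 / k i := by
      have : 1 / k i ≤ 1 := by rw [div_le_one (by linarith [hk i])]; exact hk i
      linarith [hk i]
    have hs : σ i * hM.eigenvalues j ≤ |hM.eigenvalues j| := by
      refine (le_abs_self _).trans ?_
      rw [abs_mul, hσ, one_mul]
    nlinarith [mul_le_mul_of_nonneg_left hs hk']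
  refine (hM.sum_affine_le_sum hv hg0 hlin).trans ?_
  have htr : ∑ j, hM.eigenvalues j ^ 2 = (D * D).trace.re + 2 * (X * Xᴴ).trace.re := by
    have h := hM.sum_eigenvalues_sq
    rw [trace_twist_mul_self X D hω hXX hXD hD] at h
    have := congrArg Complex.re h
    rw [Complex.ofReal_re] at this
    simpa using this
  simp only [hg, Finset.sum_add_distrib, Finset.sum_sub_distrib, ← Finset.mul_sum, htr,
    Finset.sum_const, Finset.card_univ, nsmul_eq_mul]
  linarith

theorem det_mul_conjTranspose_re (A : Matrix ι ι ℂ) :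
    (A * Aᴴ).det.re = ‖A.det‖ ^ 2 := by
  rw [det_mul, det_conjTranspose, Complex.star_def, Complex.mul_conj, Complex.normSq_eq_norm_sq,
    Complex.ofReal_re]

end Matrix

/-! ### Truncating eigenvectors to the ring -/

theorem hasSum_norm_sq {m : ℕ} (u : SeqSpace m) : HasSum (fun n => ‖u n‖ ^ 2) (‖u‖ ^ 2) := by
  have := lp.hasSum_norm (p := 2) (by norm_num) u
  simpa using this

theorem sum_fin_eq_sum_Icc {α : Type*} [AddCommMonoid α] (f : ℤ → α) (N : ℕ) :
    ∑ j : Fin (2 * N + 1), f ((j : ℤ) - N) = ∑ n ∈ Finset.Icc (-N : ℤ) N, f n := by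
  rw [Fin.sum_univ_eq_sum_range (fun j : ℕ => f ((j : ℤ) - N))]
  refine Finset.sum_bij' (fun j _ => (j : ℤ) - N) (fun n _ => (n + N).toNat) ?_ ?_ ?_ ?_ ?_
  · intro j hj
    simp only [Finset.mem_range, Finset.mem_Icc] at hj ⊢
    omega
  · intro n hn
    simp only [Finset.mem_range, Finset.mem_Icc] at hn ⊢
    omega
  · intro j hj
    simp
  · intro n hn
    simp only [Finset.mem_Icc] at hn
    omega
  · intro j _
    rfl

namespace MatrixJacobi

variable {m : ℕ} (J : MatrixJacobi m)

theorem det_A_ne_zero (n : ℤ) : (J.A n).det ≠ 0 :=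
  ((Matrix.isUnit_iff_isUnit_det _).mp (J.isUnit_A n)).ne_zero

theorem offDiagonalTerm_eq (n : ℤ) : J.offDiagonalTerm n
    = (J.A n * (J.A n)ᴴ).trace.re - m - 2 * Real.log ‖(J.A n).det‖ := by
  rw [offDiagonalTerm, Matrix.det_mul_conjTranspose_re, Real.log_pow, Matrix.trace_sub,
    Matrix.trace_one]
  simp

theorem potentialTerm_nonneg (n : ℤ) : 0 ≤ J.potentialTerm n := by
  have := congrArg Complex.re (J.isHermitian_B n).sum_eigenvalues_sq
  rw [Complex.ofReal_re] at this
  rw [potentialTerm, pow_two, ← this]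
  positivity

-- Each eigenvalue `s > 0` of `A A*` contributes `s - 1 - log s ≥ 0`.
open scoped ComplexOrder in
theorem offDiagonalTerm_nonneg (n : ℤ) : 0 ≤ J.offDiagonalTerm n := by
  have hpd : (J.A n * (J.A n)ᴴ).PosDef :=
    Matrix.PosDef.mul_conjTranspose_self _ (Matrix.vecMul_injective_of_isUnit (J.isUnit_A n))
  have hH := hpd.isHermitian
  have ht := hH.trace_eq_sum_eigenvalues
  have hd := hH.det_eq_prod_eigenvalues
  rw [offDiagonalTerm, Matrix.trace_sub, Matrix.trace_one, ht, hd]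
  have e1 : (∏ i, ((hH.eigenvalues i : ℝ) : ℂ)).re = ∏ i, hH.eigenvalues i := by
    rw [← Complex.ofReal_prod, Complex.ofReal_re]
  have e2 : (∑ i, ((hH.eigenvalues i : ℝ) : ℂ) - (Fintype.card (Fin m) : ℂ)).re
      = ∑ i, (hH.eigenvalues i - 1) := by
    simp
  erw [e1, e2]
  rw [Real.log_prod fun i _ => (hpd.eigenvalues_pos i).ne', ← Finset.sum_sub_distrib]
  refine Finset.sum_nonneg fun i _ => ?_
  linarith [Real.log_le_sub_one_of_pos (hpd.eigenvalues_pos i)]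

/-- Restriction to the sites `-N, …, N`, viewed as a ring, with the phase `ω̄ ^ j` at the `j`-th
site. -/
def ringRestrictₗ (N : ℕ) (ω : ℂ) :
    SeqSpace m →ₗ[ℂ] EuclideanSpace ℂ (Fin m × Fin (2 * N + 1)) where
  toFun u := WithLp.toLp 2 fun p => star ω ^ (p.2 : ℕ) * u ((p.2 : ℤ) - N) p.1
  map_add' u v := by
    ext p
    simp [mul_add]
  map_smul' c u := by
    ext p
    simp
    ring

theorem slice_ringRestrictₗ (N : ℕ) (ω : ℂ) (u : SeqSpace m) (j : Fin (2 * N + 1)) :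
    Matrix.slice (ringRestrictₗ N ω u) j = star ω ^ (j : ℕ) • u ((j : ℤ) - N) := by
  ext a
  simp [Matrix.slice, ringRestrictₗ]

theorem norm_ringRestrictₗ_sq (N : ℕ) {ω : ℂ} (hω : ‖ω‖ = 1) (u : SeqSpace m) :
    ‖ringRestrictₗ N ω u‖ ^ 2 = ∑ n ∈ Finset.Icc (-N : ℤ) N, ‖u n‖ ^ 2 := by
  rw [Matrix.norm_sq_eq_sum_norm_slice_sq, ← sum_fin_eq_sum_Icc]
  refine Finset.sum_congr rfl fun j _ => ?_
  rw [slice_ringRestrictₗ, norm_smul, norm_pow, norm_star, hω, one_pow, one_mul]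

theorem norm_ringRestrictₗ_le (N : ℕ) {ω : ℂ} (hω : ‖ω‖ = 1) (u : SeqSpace m) :
    ‖ringRestrictₗ N ω u‖ ≤ 1 * ‖u‖ := by
  rw [one_mul]
  refine le_of_sq_le_sq ?_ (norm_nonneg _)
  rw [norm_ringRestrictₗ_sq N hω]
  exact sum_le_hasSum _ (fun n _ => sq_nonneg _) (hasSum_norm_sq u)

/-- Truncation destroys orthonormality but is a contraction, so moving its adjoint onto `e`
preserves Bessel's inequality. -/
theorem sum_norm_inner_ringRestrictₗ_sq_le (N : ℕ) {ω : ℂ} (hω : ‖ω‖ = 1) {κ : Type*} [Fintype κ]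
    {u : κ → SeqSpace m} (hu : Orthonormal ℂ u) (e : EuclideanSpace ℂ (Fin m × Fin (2 * N + 1))) :
    ∑ i, ‖inner ℂ e (ringRestrictₗ N ω (u i))‖ ^ 2 ≤ ‖e‖ ^ 2 := by
  set T := (ringRestrictₗ (m := m) N ω).mkContinuous 1 (norm_ringRestrictₗ_le N hω) with hT
  have hTn : ‖ContinuousLinearMap.adjoint T e‖ ≤ ‖e‖ := by
    have h1 : ‖ContinuousLinearMap.adjoint T‖ ≤ 1 := by
      rw [LinearIsometryEquiv.norm_map]
      exact LinearMap.mkContinuous_norm_le _ zero_le_one _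
    simpa using (ContinuousLinearMap.adjoint T).le_of_opNorm_le h1 e
  calc ∑ i, ‖inner ℂ e (ringRestrictₗ N ω (u i))‖ ^ 2
      = ∑ i, ‖inner ℂ (u i) (ContinuousLinearMap.adjoint T e)‖ ^ 2 := by
        refine Finset.sum_congr rfl fun i _ => ?_
        rw [norm_inner_symm, ContinuousLinearMap.adjoint_inner_right]
        rfl
    _ ≤ ‖ContinuousLinearMap.adjoint T e‖ ^ 2 := hu.sum_inner_products_le _
    _ ≤ ‖e‖ ^ 2 := by gcongr

/-- The operator `W` restricted to the sites `-N, …, N` and closed to a ring, with the phase `ω` on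
each edge. -/
def ringMatrix (N : ℕ) (ω : ℂ) :
    Matrix (Fin m × Fin (2 * N + 1)) (Fin m × Fin (2 * N + 1)) ℂ :=
  Matrix.twist (Matrix.ringShift fun j : Fin (2 * N + 1) => J.A ((j : ℤ) - N))
    (Matrix.blockDiagonal fun j : Fin (2 * N + 1) => J.B ((j : ℤ) - N)) ω

/-- The site phases `ω̄^j` gauge away the edge phases. Only the edge closing the ring is wrong, and
it meets only the two excluded sites. -/
theorem slice_ringMatrix_ringRestrictₗ {lam : ℝ} {u : SeqSpace m} (hu : u ∈ J.eigenspace lam)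
    (N : ℕ) {ω : ℂ} (hω : ‖ω‖ = 1) {j : Fin (2 * N + 1)} (h0 : j ≠ 0) (h1 : j ≠ Fin.last (2 * N)) :
    Matrix.slice (Matrix.toEuclideanCLM (n := Fin m × Fin (2 * N + 1)) (𝕜 := ℂ)
        (J.ringMatrix N ω) (ringRestrictₗ N ω u)) j
      = (lam : ℂ) • Matrix.slice (ringRestrictₗ N ω u) j := by
  have hωs : ω * star ω = 1 := by
    rw [Complex.star_def, Complex.mul_conj, Complex.normSq_eq_norm_sq, hω]; simp
  have hs : ((j + 1 : Fin (2 * N + 1)) : ℕ) = j + 1 := by rw [Fin.val_add_one, if_neg h1]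
  obtain ⟨i, hi⟩ : ∃ i : ℕ, (j : ℕ) = i + 1 :=
    Nat.exists_eq_succ_of_ne_zero fun h => h0 (Fin.ext h)
  have hp : ((j - 1 : Fin (2 * N + 1)) : ℕ) = i := by
    have h := Fin.val_add_one (j - 1)
    rw [sub_add_cancel] at h
    split_ifs at h with hc
    · exact absurd (Fin.ext h) h0
    · omega
  have hu' := J.eigenspace_apply hu ((j : ℤ) - N)
  rw [ringMatrix, Matrix.slice_toEuclideanCLM_twist]
  simp only [slice_ringRestrictₗ, hs, hp]
  rw [smul_comm (lam : ℂ), ← hu', map_smul, map_smul, map_smul, smul_smul, smul_smul, smul_add,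
    smul_add]
  have e1 : ω * star ω ^ ((j : ℕ) + 1) = star ω ^ (j : ℕ) := by
    rw [pow_succ, mul_left_comm, hωs, mul_one]
  have e2 : star ω * star ω ^ i = star ω ^ (j : ℕ) := by rw [hi, pow_succ']
  have e3 : ((i : ℕ) : ℤ) - N = (j : ℤ) - N - 1 := by rw [hi]; push_cast; ring
  have e4 : (((j : ℕ) + 1 : ℕ) : ℤ) - N = (j : ℤ) - N + 1 := by push_cast; ring
  rw [e1, e2, e3, e4, add_comm (star ω ^ (j : ℕ) • matOp _ _) (star ω ^ (j : ℕ) • matOp _ _)]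

theorem exists_ringMatrix_form_bound (lam : ℝ) :
    ∃ K : ℝ, ∀ u ∈ J.eigenspace lam, ‖u‖ = 1 → ∀ (N : ℕ) (ω : ℂ), ‖ω‖ = 1 →
      |(inner ℂ (ringRestrictₗ N ω u) (Matrix.toEuclideanCLM (n := Fin m × Fin (2 * N + 1)) (𝕜 := ℂ)
        (J.ringMatrix N ω) (ringRestrictₗ N ω u))).re - lam * ‖ringRestrictₗ N ω u‖ ^ 2|
      ≤ K * (‖u (-N)‖ + ‖u N‖) := by
  obtain ⟨a, ha⟩ := J.bounded_A
  obtain ⟨a', ha'⟩ := J.bounded_A_conjTranspose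
  obtain ⟨b, hb⟩ := J.bounded_B
  -- The four terms bound the four parts of the residual at one site, since `‖u n‖ ≤ 1`. The
  -- constant is independent of `N` and `ω`, so the error vanishes as `N` grows.
  refine ⟨a + a' + b + |lam|, fun u hu hu1 N ω hω => ?_⟩
  have hun : ∀ n, ‖u n‖ ≤ 1 := fun n => hu1 ▸ lp.norm_apply_le_norm (by norm_num) u n
  set v := ringRestrictₗ N ω u with hv
  set y := Matrix.toEuclideanCLM (n := Fin m × Fin (2 * N + 1)) (𝕜 := ℂ) (J.ringMatrix N ω) v with hy
  have hsl : ∀ j, ‖Matrix.slice v j‖ = ‖u ((j : ℤ) - N)‖ := fun j => by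
    rw [hv, slice_ringRestrictₗ, norm_smul, norm_pow, norm_star, hω, one_pow, one_mul]
  have ha0 : 0 ≤ a := (norm_nonneg _).trans (ha 0)
  have ha0' : 0 ≤ a' := (norm_nonneg _).trans (ha' 0)
  have hb0 : 0 ≤ b := (norm_nonneg _).trans (hb 0)
  have herr : ∀ j, ‖Matrix.slice y j - (lam : ℂ) • Matrix.slice v j‖ ≤ a + a' + b + |lam| := by
    intro j
    have hj : ∀ j, ‖Matrix.slice v j‖ ≤ 1 := fun j => (hsl j).trans_le (hun _)
    rw [hy, ringMatrix, Matrix.slice_toEuclideanCLM_twist]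
    refine (norm_sub_le _ _).trans (add_le_add ((norm_add_le _ _).trans (add_le_add
      ((norm_add_le _ _).trans (add_le_add ?_ ?_)) ?_)) ?_)
    · rw [norm_smul, hω, one_mul]
      exact ((matOp _).le_of_opNorm_le (ha _) _).trans (mul_le_of_le_one_right ha0 (hj _))
    · rw [norm_smul, norm_star, hω, one_mul]
      have := ha' ((((j - 1 : Fin (2 * N + 1)) : ℕ) : ℤ) - N + 1)
      rw [add_sub_cancel_right] at this
      exact ((matOp _).le_of_opNorm_le this _).trans (mul_le_of_le_one_right ha0' (hj _))
    · exact ((matOp _).le_of_opNorm_le (hb _) _).trans (mul_le_of_le_one_right hb0 (hj _))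
    · rw [norm_smul, Complex.norm_real, Real.norm_eq_abs]
      exact mul_le_of_le_one_right (abs_nonneg _) (hj _)
  have hrew : (inner ℂ v y).re - lam * ‖v‖ ^ 2
      = (∑ j, inner ℂ (Matrix.slice v j) (Matrix.slice y j - (lam : ℂ) • Matrix.slice v j)).re := by
    simp only [inner_sub_right, Finset.sum_sub_distrib, inner_smul_right, ← Finset.mul_sum,
      ← Matrix.inner_eq_sum_inner_slice, Complex.sub_re]
    rw [Complex.re_ofReal_mul]
    congr 2
    exact (inner_self_eq_norm_sq (𝕜 := ℂ) v).symm
  rw [hrew]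
  refine (Complex.abs_re_le_norm _).trans ((norm_sum_le _ _).trans ?_)
  set K := a + a' + b + |lam| with hK
  calc ∑ j, ‖inner ℂ (Matrix.slice v j) (Matrix.slice y j - (lam : ℂ) • Matrix.slice v j)‖
      ≤ ∑ j : Fin (2 * N + 1), ((if j = 0 then K * ‖u (-N)‖ else 0)
          + if j = Fin.last (2 * N) then K * ‖u N‖ else 0) := by
        refine Finset.sum_le_sum fun j _ => ?_
        have hK0 : 0 ≤ K := by positivity
        have hgen : ‖inner ℂ (Matrix.slice v j) (Matrix.slice y j - (lam : ℂ) • Matrix.slice v j)‖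
            ≤ K * ‖u ((j : ℤ) - N)‖ := by
          refine (norm_inner_le_norm _ _).trans ?_
          rw [hsl, mul_comm]
          exact mul_le_mul_of_nonneg_right (herr j) (norm_nonneg _)
        by_cases h0 : j = 0
        · rw [if_pos h0]
          refine hgen.trans ?_
          rw [h0, Fin.val_zero, Nat.cast_zero, zero_sub]
          exact le_add_of_nonneg_right (by split_ifs <;> positivity)
        by_cases h1 : j = Fin.last (2 * N)
        · rw [if_neg h0, if_pos h1, zero_add]
          refine hgen.trans_eq ?_
          rw [h1, Fin.val_last, show ((2 * N : ℕ) : ℤ) - N = N by push_cast; ring]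
        · rw [if_neg h0, if_neg h1, hy, hv, J.slice_ringMatrix_ringRestrictₗ hu N hω h0 h1, sub_self,
            inner_zero_right, norm_zero, add_zero]
    _ = K * (‖u (-N)‖ + ‖u N‖) := by
        rw [Finset.sum_add_distrib, Finset.sum_ite_eq' , Finset.sum_ite_eq']
        simp [mul_add]

end MatrixJacobi

/-! ### Passage to the limit and the inequality -/

namespace MatrixJacobi

variable {m : ℕ} (J : MatrixJacobi m)

/-- The sum of the weights of an orthonormal family of eigenvectors is bounded by the total. -/
theorem sum_moment_le_of_orthonormal (hB : Summable J.potentialTerm)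
    (hA : Summable J.offDiagonalTerm) {κ : Type*} [Fintype κ] {u : κ → SeqSpace m}
    (hu : Orthonormal ℂ u) {lam k : κ → ℝ} (hlam : ∀ i, u i ∈ J.eigenspace (lam i))
    (hk : ∀ i, 1 ≤ k i) (hlk : ∀ i, |lam i| = k i + 1 / k i) :
    ∑ i, moment (k i) ≤ (∑' n, J.potentialTerm n) + 2 * ∑' n, J.offDiagonalTerm n := by
  choose K hK using fun i => J.exists_ringMatrix_form_bound (lam i)
  set R := (∑' n, J.potentialTerm n) + 2 * ∑' n, J.offDiagonalTerm n with hR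
  set c : κ → ℝ := fun i => 2 * (k i - 1 / k i) with hc
  have hc0 : ∀ i, 0 ≤ c i := fun i => by
    have : 1 / k i ≤ 1 := by rw [div_le_one (by linarith [hk i])]; exact hk i
    simp only [hc]
    linarith [hk i]
  set σ : κ → ℝ := fun i => if 0 ≤ lam i then 1 else -1 with hσ
  have hσ1 : ∀ i, |σ i| = 1 := fun i => by simp only [hσ]; split_ifs <;> simp
  have hσlam : ∀ i, σ i * lam i = k i + 1 / k i := fun i => by
    rw [← hlk]
    simp only [hσ]
    split_ifs with h
    · rw [one_mul, abs_of_nonneg h]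
    · rw [abs_of_neg (not_le.mp h)]; ring
  have hfin : ∀ N : ℕ, 1 ≤ N → ∀ ε : ℝ, 0 < ε →
      ∑ i, (moment (k i) * ∑ n ∈ Finset.Icc (-N : ℤ) N, ‖u i n‖ ^ 2
        - c i * (K i * (‖u i (-N)‖ + ‖u i N‖)))
      ≤ R + Fintype.card (Fin m × Fin (2 * N + 1)) * (2 * ε * (ε + 2)) := by
    intro N hN ε hε
    set AN : Fin (2 * N + 1) → Matrix (Fin m) (Fin m) ℂ := fun j => J.A ((j : ℤ) - N) with hAN
    set BN : Fin (2 * N + 1) → Matrix (Fin m) (Fin m) ℂ := fun j => J.B ((j : ℤ) - N) with hBN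
    have hdet : ‖(Matrix.ringShift AN).det‖ = ∏ j, ‖(AN j).det‖ := Matrix.norm_det_ringShift AN
    have hX : (Matrix.ringShift AN).det ≠ 0 := by
      rw [← norm_ne_zero_iff, hdet, Finset.prod_ne_zero_iff]
      exact fun j _ => norm_ne_zero_iff.mpr (J.det_A_ne_zero _)
    have hD : (Matrix.blockDiagonal BN).IsHermitian := by
      rw [Matrix.IsHermitian, Matrix.blockDiagonal_conjTranspose]
      congr 1
      funext j
      exact (J.isHermitian_B _).eq
    obtain ⟨ω, hω, hle⟩ := Matrix.exists_twist_sum_moment_le (κ := κ) hX hD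
      (Matrix.trace_ringShift_mul_self (by omega) AN)
      (Matrix.trace_ringShift_mul_blockDiagonal (by omega) AN BN) hε
    have hle := hle (fun i => ringRestrictₗ N ω (u i)) k σ
      (sum_norm_inner_ringRestrictₗ_sq_le N hω hu) hk hσ1
    have hpot : (Matrix.blockDiagonal BN * Matrix.blockDiagonal BN).trace.re
        = ∑ n ∈ Finset.Icc (-N : ℤ) N, J.potentialTerm n := by
      rw [← Matrix.blockDiagonal_mul, Matrix.trace_blockDiagonal, Complex.re_sum,
        ← sum_fin_eq_sum_Icc]
      exact Finset.sum_congr rfl fun j _ => by rw [potentialTerm, pow_two]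
    have hoff : 2 * (Matrix.ringShift AN * (Matrix.ringShift AN)ᴴ).trace.re
        - 2 * Fintype.card (Fin m × Fin (2 * N + 1)) - 4 * Real.log ‖(Matrix.ringShift AN).det‖
        = 2 * ∑ n ∈ Finset.Icc (-N : ℤ) N, J.offDiagonalTerm n := by
      rw [Matrix.ringShift_mul_conjTranspose, Matrix.trace_blockDiagonal, Complex.re_sum, hdet,
        Real.log_prod fun j _ => norm_ne_zero_iff.mpr (J.det_A_ne_zero _), ← sum_fin_eq_sum_Icc]
      simp only [offDiagonalTerm_eq, Finset.sum_sub_distrib, ← Finset.mul_sum]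
      simp [hAN]
      ring
    have hpot_le : ∑ n ∈ Finset.Icc (-N : ℤ) N, J.potentialTerm n ≤ ∑' n, J.potentialTerm n :=
      hB.sum_le_tsum _ fun n _ => J.potentialTerm_nonneg n
    have hoff_le : ∑ n ∈ Finset.Icc (-N : ℤ) N, J.offDiagonalTerm n ≤ ∑' n, J.offDiagonalTerm n :=
      hA.sum_le_tsum _ fun n _ => J.offDiagonalTerm_nonneg n
    refine le_trans (le_trans (Finset.sum_le_sum fun i _ => ?_) hle) ?_
    · have hb := hK i (u i) (hlam i) (hu.1 i) N ω hω
      rw [ringMatrix] at hb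
      rw [← norm_ringRestrictₗ_sq N hω]
      set q := (inner ℂ (ringRestrictₗ N ω (u i)) (Matrix.toEuclideanCLM
        (n := Fin m × Fin (2 * N + 1)) (𝕜 := ℂ)
        (Matrix.twist (Matrix.ringShift AN) (Matrix.blockDiagonal BN) ω)
        (ringRestrictₗ N ω (u i)))).re with hq
      set s := ‖ringRestrictₗ N ω (u i)‖ ^ 2 with hs
      have h1 : -(K i * (‖u i (-N)‖ + ‖u i N‖)) ≤ σ i * (q - lam i * s) := by
        have := (neg_abs_le (σ i * (q - lam i * s)))
        rw [abs_mul, hσ1, one_mul] at this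
        linarith
      have h2 := mul_le_mul_of_nonneg_left h1 (hc0 i)
      have h3 : c i * (σ i * (q - lam i * s)) = c i * σ i * q - c i * (k i + 1 / k i) * s := by
        rw [← hσlam]; ring
      simp only [hc] at h2 h3 ⊢
      linarith
    · linarith
  -- The error in `ε` is proportional to the number of sites, so `ε → 0` is taken at fixed `N`. The
  -- phase depends on `ε` but no longer appears.
  have hlim : ∀ N : ℕ, 1 ≤ N →
      ∑ i, (moment (k i) * ∑ n ∈ Finset.Icc (-N : ℤ) N, ‖u i n‖ ^ 2
        - c i * (K i * (‖u i (-N)‖ + ‖u i N‖))) ≤ R := by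
    intro N hN
    have ht : Tendsto (fun ε : ℝ => R + Fintype.card (Fin m × Fin (2 * N + 1)) * (2 * ε * (ε + 2)))
        (𝓝[>] 0) (𝓝 R) := by
      have : Continuous fun ε : ℝ =>
          R + Fintype.card (Fin m × Fin (2 * N + 1)) * (2 * ε * (ε + 2)) := by fun_prop
      have := this.tendsto 0
      simp only [mul_zero, zero_mul, add_zero] at this
      exact this.mono_left nhdsWithin_le_nhds
    exact ge_of_tendsto ht (eventually_nhdsWithin_of_forall fun ε hε => hfin N hN ε hε)
  have htend : Tendsto (fun N : ℕ => ∑ i, (moment (k i) * ∑ n ∈ Finset.Icc (-N : ℤ) N, ‖u i n‖ ^ 2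
        - c i * (K i * (‖u i (-N)‖ + ‖u i N‖)))) atTop
      (𝓝 (∑ i, (moment (k i) * 1 - c i * (K i * (0 + 0))))) := by
    refine tendsto_finsetSum _ fun i _ => ((Tendsto.const_mul _ ?_).sub
      (((Tendsto.add ?_ ?_).const_mul _).const_mul _))
    · have := hasSum_norm_sq (u i)
      rw [hu.1 i, one_pow] at this
      exact this.comp Finset.tendsto_Icc_neg
    · refine (tendsto_apply_cofinite_zero (u i)).comp ?_
      rw [← Nat.cofinite_eq_atTop]
      exact Function.Injective.tendsto_cofinite fun a b h => by simpa using h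
    · refine (tendsto_apply_cofinite_zero (u i)).comp ?_
      rw [← Nat.cofinite_eq_atTop]
      exact Function.Injective.tendsto_cofinite fun a b h => by simpa using h
  have := le_of_tendsto htend (eventually_atTop.mpr ⟨1, hlim⟩)
  simpa using this

theorem eigenTerm_eq {lam : ℝ} : J.eigenTerm lam = J.multiplicity lam * moment |kOf lam| := by
  rw [eigenTerm, moment, sq_abs, Real.log_pow]
  norm_num

theorem one_lt_abs_kOf {lam : ℝ} (h : 2 < |lam|) : 1 < |kOf lam| :=
  ((kOf_unique h _).mpr rfl).1

theorem abs_eq_abs_kOf_add {lam : ℝ} (h : 2 < |lam|) : |lam| = |kOf lam| + 1 / |kOf lam| := by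
  obtain ⟨h1, h2⟩ := (kOf_unique h _).mpr rfl
  conv_lhs => rw [h2]
  rcases lt_abs.mp h1 with hk | hk
  · have : 0 < 1 / kOf lam := by positivity
    rw [abs_of_neg (by linarith), abs_of_pos (by linarith : 0 < kOf lam)]; ring
  · have : 1 / kOf lam < 0 := one_div_neg.mpr (by linarith)
    rw [abs_of_pos (by linarith), abs_of_neg (by linarith : kOf lam < 0)]
    rw [one_div, one_div, inv_neg]; ring

/-- The tangent at `1` gives only nonnegativity; the tangent at the midpoint of `1` and `κ` has
positive slope and gives strictness. -/
theorem moment_pos {κ : ℝ} (hκ : 1 < κ) : 0 < moment κ := by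
  have h := moment_tangent_le (κ := (1 + κ) / 2) (ρ := κ) (by linarith) hκ.le
  have h0 := moment_tangent_le (κ := 1) (ρ := (1 + κ) / 2) le_rfl (by linarith)
  have e : moment 1 = 0 := by simp [moment]
  rw [e] at h0
  set t := (1 + κ) / 2 with ht
  have ht1 : 1 < t := by linarith
  have h1 : 0 < t - 1 / t := by
    have : 1 / t < 1 := by rw [div_lt_one (by linarith)]; exact ht1
    linarith
  have h2 : 0 < (κ + 1 / κ) - (t + 1 / t) := by
    have : (κ + 1 / κ) - (t + 1 / t) = (κ - t) * (1 - 1 / (κ * t)) := by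
      field_simp
      ring
    rw [this]
    have hκt : 1 < κ * t := by nlinarith
    have : 1 / (κ * t) < 1 := by rw [div_lt_one (by linarith)]; exact hκt
    exact mul_pos (by linarith) (by linarith)
  nlinarith [mul_pos h1 h2]

theorem eigenTerm_nonneg {lam : ℝ} (h : 2 < |lam|) : 0 ≤ J.eigenTerm lam := by
  rw [eigenTerm_eq]
  exact mul_nonneg (Nat.cast_nonneg _) (moment_pos (one_lt_abs_kOf h)).le

theorem multiplicity_pos {lam : ℝ} (h : lam ∈ J.outerEigenvalues) : 0 < J.multiplicity lam := by
  have := J.finiteDimensional_eigenspace lam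
  rw [multiplicity, Module.finrank_pos_iff, Submodule.nontrivial_iff_ne_bot]
  exact h.2

theorem eigenTerm_pos {lam : ℝ} (h : lam ∈ J.outerEigenvalues) : 0 < J.eigenTerm lam := by
  rw [eigenTerm_eq]
  exact mul_pos (Nat.cast_pos.mpr (J.multiplicity_pos h)) (moment_pos (one_lt_abs_kOf h.1))

/-- Orthonormal bases of the mutually orthogonal eigenspaces form one orthonormal family, in which
each eigenvalue occurs as often as its multiplicity. -/
theorem sum_eigenTerm_le (hB : Summable J.potentialTerm) (hA : Summable J.offDiagonalTerm)
    (s : Finset J.outerEigenvalues) :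
    ∑ lam ∈ s, J.eigenTerm lam
      ≤ (∑' n, J.potentialTerm n) + 2 * ∑' n, J.offDiagonalTerm n := by
  have hfd := J.finiteDimensional_eigenspace
  have hsymm : (J.W : SeqSpace m →ₗ[ℂ] SeqSpace m).IsSymmetric := fun u v => J.inner_W_left u v
  have horth := hsymm.orthogonalFamily_eigenspaces.comp
    (γ := s) (f := fun lam => ((lam : ℝ) : ℂ))
    (fun a b h => Subtype.ext (Subtype.ext (Complex.ofReal_injective h)))
  have hon := horth.orthonormal_sigma_orthonormal
    (α := fun lam : s => Fin (Module.finrank ℂ (J.eigenspace (lam : ℝ))))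
    (v_family := fun lam => stdOrthonormalBasis ℂ (J.eigenspace (lam : ℝ)))
    (fun lam => (stdOrthonormalBasis ℂ (J.eigenspace (lam : ℝ))).orthonormal)
  have h := J.sum_moment_le_of_orthonormal hB hA hon (lam := fun p => (p.1 : ℝ))
    (k := fun p => |kOf (p.1 : ℝ)|) (fun p => Subtype.mem _)
    (fun p => (one_lt_abs_kOf p.1.1.2.1).le) (fun p => abs_eq_abs_kOf_add p.1.1.2.1)
  refine le_trans (le_of_eq ?_) h
  rw [Fintype.sum_sigma, ← Finset.sum_coe_sort]
  refine Finset.sum_congr rfl fun lam _ => ?_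
  rw [eigenTerm_eq]
  simp [multiplicity]

theorem summable_eigenTerm (hB : Summable J.potentialTerm) (hA : Summable J.offDiagonalTerm) :
    Summable fun lam : J.outerEigenvalues => J.eigenTerm lam :=
  summable_of_sum_le (fun lam => J.eigenTerm_nonneg lam.2.1) (J.sum_eigenTerm_le hB hA)

theorem tsum_eigenTerm_le (hB : Summable J.potentialTerm) (hA : Summable J.offDiagonalTerm) :
    ∑' lam : J.outerEigenvalues, J.eigenTerm lam
      ≤ (∑' n, J.potentialTerm n) + 2 * ∑' n, J.offDiagonalTerm n :=
  (J.summable_eigenTerm hB hA).tsum_le_of_sum_le (J.sum_eigenTerm_le hB hA)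

end MatrixJacobi

/-! ### The extremal operators -/

theorem hasSum_int_telescope {y : ℤ → ℝ} {a b : ℝ} (hmono : ∀ n, y n ≤ y (n + 1))
    (hb : Tendsto (fun n : ℕ => y n) atTop (𝓝 b)) (ha : Tendsto (fun n : ℕ => y (-n)) atTop (𝓝 a)) :
    HasSum (fun n => y (n + 1) - y n) (b - a) := by
  have h1 : HasSum (fun n : ℕ => y ((n : ℤ) + 1) - y n) (b - y 0) := by
    rw [hasSum_iff_tendsto_nat_of_nonneg fun n => sub_nonneg.mpr (hmono n)]
    have : ∀ N : ℕ, ∑ n ∈ Finset.range N, (y ((n : ℤ) + 1) - y n) = y N - y 0 := fun N => by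
      simpa using Finset.sum_range_sub (fun n : ℕ => y n) N
    simp only [this]
    exact hb.sub_const _
  have h2 : HasSum (fun n : ℕ => y (-((n : ℤ) + 1) + 1) - y (-((n : ℤ) + 1))) (y 0 - a) := by
    rw [hasSum_iff_tendsto_nat_of_nonneg fun n => sub_nonneg.mpr (hmono _)]
    have : ∀ N : ℕ, ∑ n ∈ Finset.range N, (y (-((n : ℤ) + 1) + 1) - y (-((n : ℤ) + 1)))
        = y 0 - y (-N) := fun N => by
      rw [← neg_zero, ← Nat.cast_zero (R := ℤ), ← Finset.sum_range_sub' (fun n : ℕ => y (-n)) N]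
      refine Finset.sum_congr rfl fun n _ => ?_
      rw [Nat.cast_add_one, neg_add_rev, neg_add_cancel_comm]
    simp only [this]
    exact ha.const_sub _
  have := HasSum.of_nat_of_neg_add_one (f := fun n => y (n + 1) - y n) h1 h2
  simpa using this

namespace Soliton

variable {k : ℝ}

/-- The positive solution `k ^ n + k ^ (-n)` of the free equation. -/
def phi (k : ℝ) (n : ℤ) : ℝ := k ^ n + k ^ (-n)

/-- The ratio of successive values of `phi`. -/
def ratio (k : ℝ) (n : ℤ) : ℝ := phi k (n + 1) / phi k n

theorem phi_pos (hk : 1 < k) (n : ℤ) : 0 < phi k n := by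
  have : 0 < k := by linarith
  unfold phi
  positivity

theorem ratio_pos (hk : 1 < k) (n : ℤ) : 0 < ratio k n := div_pos (phi_pos hk _) (phi_pos hk _)

theorem phi_add_two (hk : 1 < k) (n : ℤ) :
    phi k (n + 1 + 1) + phi k n = (k + 1 / k) * phi k (n + 1) := by
  have hk0 : k ≠ 0 := by linarith
  unfold phi
  rw [zpow_add_one₀ hk0 (n + 1), zpow_add_one₀ hk0 n, neg_add (n + 1), neg_add n,
    zpow_add₀ hk0 (-n + -1), zpow_add₀ hk0 (-n), zpow_neg_one]
  field_simp
  ring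

theorem phi_wronskian (hk : 1 < k) (n : ℤ) :
    phi k (n + 1 + 1) * phi k n - phi k (n + 1) ^ 2 = (k - 1 / k) ^ 2 := by
  have hk0 : k ≠ 0 := by linarith
  have hz : k ^ n ≠ 0 := zpow_ne_zero n hk0
  unfold phi
  rw [zpow_add_one₀ hk0 (n + 1), zpow_add_one₀ hk0 n, neg_add (n + 1), neg_add n,
    zpow_add₀ hk0 (-n + -1), zpow_add₀ hk0 (-n), zpow_neg_one, zpow_neg]
  field_simp
  ring

/-- This is the Riccati form of the free equation, and it drives all later identities. -/
theorem ratio_succ_add_inv (hk : 1 < k) (n : ℤ) : ratio k (n + 1) + 1 / ratio k n = k + 1 / k := by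
  have h1 := (phi_pos hk n).ne'
  have h2 := (phi_pos hk (n + 1)).ne'
  have h := phi_add_two hk n
  rw [ratio, ratio, one_div_div, ← add_div, h, mul_div_assoc, div_self h2, mul_one]

theorem ratio_lt (hk : 1 < k) (n : ℤ) : ratio k n < k + 1 / k := by
  have h := ratio_succ_add_inv hk (n - 1)
  rw [sub_add_cancel] at h
  have := one_div_pos.mpr (ratio_pos hk (n - 1))
  linarith

theorem inv_ratio_lt (hk : 1 < k) (n : ℤ) : 1 / ratio k n < k + 1 / k := by
  have h := ratio_succ_add_inv hk n
  have := ratio_pos hk (n + 1)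
  linarith

/-- By the Wronskian identity the increments are positive multiples of `ψ(n)²`. This yields both the
monotonicity of `ratio` and, by telescoping, the square-summability of the bound state. -/
theorem ratio_succ_sub (hk : 1 < k) (n : ℤ) :
    ratio k (n + 1) - ratio k n = (k - 1 / k) ^ 2 * (1 / (phi k n * phi k (n + 1))) := by
  have h1 := (phi_pos hk n).ne'
  have h2 := (phi_pos hk (n + 1)).ne'
  rw [← phi_wronskian hk n, ratio, ratio]
  field_simp

theorem sub_inv_pos (hk : 1 < k) : 0 < k - 1 / k := by
  have : 1 / k < 1 := by rw [div_lt_one (by linarith)]; exact hk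
  linarith

theorem ratio_lt_succ (hk : 1 < k) (n : ℤ) : ratio k n < ratio k (n + 1) := by
  rw [← sub_pos, ratio_succ_sub hk]
  have := sub_inv_pos hk
  have := phi_pos hk n
  have := phi_pos hk (n + 1)
  positivity

theorem tendsto_ratio_atTop (hk : 1 < k) :
    Tendsto (fun n : ℕ => ratio k n) atTop (𝓝 k) := by
  have hk0 : 0 < k := by linarith
  set r : ℝ := (1 / k) ^ 2 with hr
  have hr1 : r < 1 := by
    have : 1 / k < 1 := by rw [div_lt_one hk0]; exact hk
    have h0 : 0 < 1 / k := by positivity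
    rw [hr]; nlinarith
  have hlim : Tendsto (fun n : ℕ => r ^ n) atTop (𝓝 0) :=
    tendsto_pow_atTop_nhds_zero_of_lt_one (by positivity) hr1
  have h := ((hlim.const_mul (1 / k)).const_add k).div (hlim.const_add 1) (by norm_num)
  simp only [mul_zero, add_zero, div_one] at h
  refine h.congr fun n => ?_
  simp only [Pi.div_apply]
  have hz : k ^ n ≠ 0 := by positivity
  have hp : 0 < 1 + r ^ n := by positivity
  rw [ratio, phi, phi, zpow_add_one₀ hk0.ne', neg_add, zpow_add₀ hk0.ne', zpow_neg_one, zpow_neg,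
    zpow_natCast, hr, ← pow_mul, mul_comm 2 n, pow_mul, one_div, inv_pow]
  field_simp

/-- As `phi` is even, reflection inverts the ratio, and the Riccati relation rewrites the inverse.
-/
theorem ratio_neg (hk : 1 < k) (n : ℤ) : ratio k (-n) = k + 1 / k - ratio k n := by
  have h := ratio_succ_add_inv hk (n - 1)
  rw [sub_add_cancel] at h
  have hs : ∀ j, phi k (-j) = phi k j := fun j => by rw [phi, phi, neg_neg, add_comm]
  have : ratio k (-n) = 1 / ratio k (n - 1) := by
    rw [ratio, ratio, one_div_div, sub_add_cancel, hs n, ← hs (n - 1)]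
    congr 2
    ring
  rw [this]
  linarith

theorem tendsto_ratio_neg (hk : 1 < k) :
    Tendsto (fun n : ℕ => ratio k (-n)) atTop (𝓝 (1 / k)) := by
  have := (tendsto_ratio_atTop hk).const_sub (k + 1 / k)
  simp only [add_sub_cancel_left] at this
  exact this.congr fun n => (ratio_neg hk n).symm

theorem hasSum_ratio_sub (hk : 1 < k) :
    HasSum (fun n => ratio k (n + 1) - ratio k n) (k - 1 / k) :=
  hasSum_int_telescope (fun n => (ratio_lt_succ hk n).le) (tendsto_ratio_atTop hk)
    (tendsto_ratio_neg hk)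

/-- The quotient of successive values of `ratio`, the square of the off-diagonal entry. -/
def quot (k : ℝ) (n : ℤ) : ℝ := ratio k (n + 1) / ratio k n

theorem one_lt_quot (hk : 1 < k) (n : ℤ) : 1 < quot k n :=
  (one_lt_div (ratio_pos hk n)).mpr (ratio_lt_succ hk n)

theorem quot_le (hk : 1 < k) (n : ℤ) : quot k n ≤ (k + 1 / k) ^ 2 := by
  rw [quot, div_eq_mul_one_div, pow_two]
  have := ratio_pos hk n
  exact mul_le_mul (ratio_lt hk _).le (inv_ratio_lt hk n).le (by positivity) (by positivity)

theorem quot_sub_one (n : ℤ) (hk : 1 < k) :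
    quot k n - 1 = (ratio k (n + 1) - ratio k n) * (1 / ratio k n) := by
  have := (ratio_pos hk n).ne'
  rw [quot]
  field_simp

theorem tendsto_quot (hk : 1 < k) : Tendsto (quot k) cofinite (𝓝 1) := by
  have h := (hasSum_ratio_sub hk).summable.tendsto_cofinite_zero.mul_const (k + 1 / k)
  rw [zero_mul] at h
  have h2 : Tendsto (fun n => quot k n - 1) cofinite (𝓝 0) := by
    refine squeeze_zero (fun n => sub_nonneg.mpr (one_lt_quot hk n).le) (fun n => ?_) h
    rw [quot_sub_one n hk]
    exact mul_le_mul_of_nonneg_left (inv_ratio_lt hk n).le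
      (sub_nonneg.mpr (ratio_lt_succ hk n).le)
  simpa using h2.add_const 1

/-- The local contribution to the right-hand side. -/
def density (k : ℝ) (n : ℤ) : ℝ :=
  (ratio k n - ratio k (n + 1)) ^ 2 + 2 * (quot k n - 1 - Real.log (quot k n))

theorem log_quot_lt (hk : 1 < k) (n : ℤ) : 0 < quot k n - 1 - Real.log (quot k n) :=
  sub_pos.mpr (Real.log_lt_sub_one_of_pos (by linarith [one_lt_quot hk n]) (one_lt_quot hk n).ne')

theorem hasSum_density (hk : 1 < k) : HasSum (density k) (moment k) := by
  set c := k + 1 / k with hc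
  have hk0 : 0 < k := by linarith
  -- Write `y = ratio k n` and `y' = ratio k (n + 1)`. Since `1/y = c - y'`, the density without its
  -- logarithm is `(y' - y)² + 2(y' - y)(c - y') = (y' - y)(2c - y - y')`, so `f` is a primitive.
  set f : ℝ → ℝ := fun t => -t ^ 2 + 2 * c * t - 2 * Real.log t with hf
  have hstep : ∀ n, f (ratio k (n + 1)) - f (ratio k n) = density k n := by
    intro n
    have h := ratio_succ_add_inv hk n
    have h0 := ratio_pos hk n
    have h1 := ratio_pos hk (n + 1)
    have hi : 1 / ratio k n = c - ratio k (n + 1) := by rw [hc]; linarith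
    rw [density, quot_sub_one n hk, hi, quot, Real.log_div h1.ne' h0.ne']
    simp only [hf]
    ring
  have hcont : ∀ t : ℝ, 0 < t → ContinuousAt f t := fun t ht => by
    have := Real.continuousAt_log ht.ne'
    fun_prop
  have h := hasSum_int_telescope (y := fun n => f (ratio k n)) (a := f (1 / k)) (b := f k)
    (fun n => by
      rw [← sub_nonneg, hstep]
      have := (log_quot_lt hk n).le
      unfold density
      positivity)
    ((hcont k hk0).tendsto.comp (tendsto_ratio_atTop hk))
    ((hcont (1 / k) (by positivity)).tendsto.comp (tendsto_ratio_neg hk))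
  simp only [hstep] at h
  convert h using 1
  simp only [hf, hc, moment]
  rw [one_div k, Real.log_inv]
  field_simp
  ring

end Soliton

theorem norm_matOp_smul_one_le {m : ℕ} (z : ℂ) :
    ‖matOp (z • (1 : Matrix (Fin m) (Fin m) ℂ))‖ ≤ ‖z‖ := by
  rw [matOp, map_smul, map_one, norm_smul]
  exact mul_le_of_le_one_right (norm_nonneg _) ContinuousLinearMap.norm_id_le

theorem matOp_smul_one_apply {m : ℕ} (z : ℂ) (x : EuclideanSpace ℂ (Fin m)) :
    matOp (z • (1 : Matrix (Fin m) (Fin m) ℂ)) x = z • x := by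
  rw [matOp, map_smul, map_one]
  rfl

namespace Soliton

variable {k : ℝ}

/-- The reflectionless operator with the single eigenvalue `-k - 1 / k` outside `[-2, 2]`. -/
def jacobi (m : ℕ) (hk : 1 < k) : MatrixJacobi m where
  A n := (-(√(quot k n) : ℝ) : ℂ) • 1
  B n := ((ratio k n - ratio k (n + 1) : ℝ) : ℂ) • 1
  isUnit_A n := by
    refine (Matrix.isUnit_iff_isUnit_det _).mpr ?_
    have : √(quot k n) ≠ 0 := (Real.sqrt_pos.mpr (by linarith [one_lt_quot hk n])).ne'
    rw [Matrix.det_smul, Matrix.det_one, mul_one]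
    exact (pow_ne_zero _ (neg_ne_zero.mpr (Complex.ofReal_ne_zero.mpr this))).isUnit
  isHermitian_B n := by
    rw [Matrix.IsHermitian, Matrix.conjTranspose_smul, Matrix.conjTranspose_one, Complex.star_def,
      Complex.conj_ofReal]
  tendsto_A := by
    have h : Tendsto (fun n => (-(√(quot k n) : ℝ) : ℂ)) cofinite (𝓝 (-1)) := by
      have := (Complex.continuous_ofReal.tendsto _).comp (tendsto_quot hk).sqrt
      simpa using this.neg
    simpa using h.smul_const (1 : Matrix (Fin m) (Fin m) ℂ)
  bounded_A := by
    refine ⟨k + 1 / k, fun n => (norm_matOp_smul_one_le _).trans ?_⟩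
    rw [norm_neg, Complex.norm_real, Real.norm_of_nonneg (Real.sqrt_nonneg _)]
    exact Real.sqrt_le_iff.mpr ⟨by positivity, quot_le hk n⟩
  bounded_B := by
    refine ⟨k + 1 / k, fun n => (norm_matOp_smul_one_le _).trans ?_⟩
    rw [Complex.norm_real, Real.norm_eq_abs, abs_sub_comm,
      abs_of_pos (sub_pos.mpr (ratio_lt_succ hk n))]
    linarith [ratio_pos hk n, ratio_lt hk (n + 1)]

variable {m : ℕ}

theorem jacobi_potentialTerm (hk : 1 < k) (n : ℤ) :
    (jacobi m hk).potentialTerm n = m * (ratio k n - ratio k (n + 1)) ^ 2 := by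
  simp only [MatrixJacobi.potentialTerm, jacobi, smul_pow, one_pow, Matrix.trace_smul,
    Matrix.trace_one, Fintype.card_fin, ← Complex.ofReal_pow, smul_eq_mul, Complex.re_ofReal_mul,
    Complex.natCast_re]
  ring

theorem jacobi_offDiagonalTerm (hk : 1 < k) (n : ℤ) :
    (jacobi m hk).offDiagonalTerm n = m * (quot k n - 1 - Real.log (quot k n)) := by
  have hq : 0 < quot k n := by linarith [one_lt_quot hk n]
  have h1 : (jacobi m hk).A n * ((jacobi m hk).A n)ᴴ
      = ((quot k n : ℝ) : ℂ) • (1 : Matrix (Fin m) (Fin m) ℂ) := by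
    simp only [jacobi]
    rw [Matrix.conjTranspose_smul, Matrix.conjTranspose_one, Matrix.smul_mul, Matrix.one_mul,
      smul_smul, star_neg, Complex.star_def, Complex.conj_ofReal, neg_mul_neg,
      ← Complex.ofReal_mul, Real.mul_self_sqrt hq.le]
  rw [MatrixJacobi.offDiagonalTerm, h1, Matrix.det_smul, Matrix.det_one, mul_one,
    Matrix.trace_sub, Matrix.trace_smul, Matrix.trace_one, Fintype.card_fin, ← Complex.ofReal_pow,
    Complex.ofReal_re, Real.log_pow, smul_eq_mul, Complex.sub_re, Complex.re_ofReal_mul,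
    Complex.natCast_re]
  ring

/-- The ground state `1 / √(φ(n) φ(n + 1))`. -/
def psi (k : ℝ) (n : ℤ) : ℝ := 1 / √(phi k n * phi k (n + 1))

theorem psi_pos (hk : 1 < k) (n : ℤ) : 0 < psi k n :=
  one_div_pos.mpr (Real.sqrt_pos.mpr (mul_pos (phi_pos hk _) (phi_pos hk _)))

theorem psi_sq (hk : 1 < k) (n : ℤ) : psi k n ^ 2 = 1 / (phi k n * phi k (n + 1)) := by
  rw [psi, div_pow, one_pow, Real.sq_sqrt (mul_pos (phi_pos hk _) (phi_pos hk _)).le]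

theorem summable_psi_sq (hk : 1 < k) : Summable fun n => psi k n ^ 2 := by
  have h := (hasSum_ratio_sub hk).summable
  simp only [ratio_succ_sub hk] at h
  have hne : (k - 1 / k) ^ 2 ≠ 0 := (pow_pos (sub_inv_pos hk) 2).ne'
  simpa only [psi_sq hk] using (summable_mul_left_iff hne).mp h

theorem sqrt_quot_mul_psi_succ (hk : 1 < k) (n : ℤ) :
    √(quot k n) * psi k (n + 1) = 1 / ratio k n * psi k n := by
  have h0 := phi_pos hk n
  have h1 := phi_pos hk (n + 1)
  have h2 := phi_pos hk (n + 1 + 1)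
  have hr := ratio_pos hk n
  have hq : 0 < quot k n := by linarith [one_lt_quot hk n]
  have hp := psi_pos hk n
  have hp' := psi_pos hk (n + 1)
  rw [← Real.sqrt_sq (by positivity : 0 ≤ 1 / ratio k n * psi k n),
    ← Real.sqrt_sq hp'.le, ← Real.sqrt_mul hq.le]
  congr 1
  rw [mul_pow, psi_sq hk, psi_sq hk, quot, ratio, ratio]
  field_simp

theorem sqrt_quot_mul_psi (hk : 1 < k) (n : ℤ) :
    √(quot k (n - 1)) * psi k (n - 1) = ratio k n * psi k n := by
  have h := sqrt_quot_mul_psi_succ hk (n - 1)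
  rw [sub_add_cancel] at h
  have hr := ratio_pos hk (n - 1)
  have hq : 0 < quot k (n - 1) := by linarith [one_lt_quot hk (n - 1)]
  have hs := Real.mul_self_sqrt hq.le
  have e : psi k (n - 1) = ratio k (n - 1) * (√(quot k (n - 1)) * psi k n) := by
    rw [h]; field_simp
  rw [e]
  have e2 : ratio k (n - 1) * quot k (n - 1) = ratio k n := by
    rw [quot, sub_add_cancel]; field_simp
  linear_combination (ratio k (n - 1) * psi k n) * hs + psi k n * e2

/-- The two neighbour terms are `-ratio k n` and `-1 / ratio k n` times `psi k n`; the potential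
replaces `ratio k n` by `ratio k (n + 1)`, and the Riccati relation finishes. -/
theorem psi_recurrence (hk : 1 < k) (n : ℤ) :
    -√(quot k (n - 1)) * psi k (n - 1) + -√(quot k n) * psi k (n + 1)
      + (ratio k n - ratio k (n + 1)) * psi k n = (-k - 1 / k) * psi k n := by
  have h1 := sqrt_quot_mul_psi hk n
  have h2 := sqrt_quot_mul_psi_succ hk n
  have h3 := ratio_succ_add_inv hk n
  linear_combination -h1 - h2 - psi k n * h3

/-- The bound states `ψ(n) x`. -/
def boundState (m : ℕ) (hk : 1 < k) : EuclideanSpace ℂ (Fin m) →ₗ[ℂ] SeqSpace m where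
  toFun x := ⟨fun n => (psi k n : ℂ) • x, memℓp_gen (by
    have := (summable_psi_sq hk).mul_right (‖x‖ ^ 2)
    refine this.congr fun n => ?_
    rw [norm_smul, Complex.norm_real, Real.norm_of_nonneg (psi_pos hk n).le]
    simp [mul_pow])⟩
  map_add' x y := by
    ext1; funext n
    exact smul_add _ _ _
  map_smul' c x := by
    ext1; funext n
    exact smul_comm _ _ _

theorem boundState_mem (hk : 1 < k) (x : EuclideanSpace ℂ (Fin m)) :
    boundState m hk x ∈ (jacobi m hk).eigenspace (-k - 1 / k) := by
  rw [MatrixJacobi.mem_eigenspace_iff]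
  ext1; funext n
  rw [MatrixJacobi.W_apply]
  change matOp (((-(√(quot k (n - 1)) : ℝ) : ℂ) • (1 : Matrix (Fin m) (Fin m) ℂ))ᴴ)
      ((psi k (n - 1) : ℂ) • x)
    + matOp ((-(√(quot k n) : ℝ) : ℂ) • (1 : Matrix (Fin m) (Fin m) ℂ)) ((psi k (n + 1) : ℂ) • x)
    + matOp (((ratio k n - ratio k (n + 1) : ℝ) : ℂ) • (1 : Matrix (Fin m) (Fin m) ℂ))
      ((psi k n : ℂ) • x) = ((-k - 1 / k : ℝ) : ℂ) • (psi k n : ℂ) • x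
  rw [Matrix.conjTranspose_smul, Matrix.conjTranspose_one, star_neg, Complex.star_def,
    Complex.conj_ofReal, matOp_smul_one_apply, matOp_smul_one_apply, matOp_smul_one_apply,
    smul_smul, smul_smul, smul_smul, smul_smul, ← add_smul, ← add_smul]
  congr 1
  exact_mod_cast psi_recurrence hk n

theorem boundState_injective (hk : 1 < k) : Function.Injective (boundState m hk) := by
  rw [← LinearMap.ker_eq_bot, LinearMap.ker_eq_bot']
  intro x hx
  have h : (psi k 0 : ℂ) • x = 0 := congrArg (fun u : SeqSpace m => u 0) hx
  exact (smul_eq_zero.mp h).resolve_left (Complex.ofReal_ne_zero.mpr (psi_pos hk 0).ne')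

theorem jacobi_multiplicity (hk : 1 < k) : (jacobi m hk).multiplicity (-k - 1 / k) = m := by
  refine le_antisymm ((jacobi m hk).multiplicity_le _) ?_
  have := (jacobi m hk).finiteDimensional_eigenspace (-k - 1 / k)
  have h := LinearMap.finrank_le_finrank_of_injective
    (f := (boundState m hk).codRestrict ((jacobi m hk).eigenspace (-k - 1 / k)) (boundState_mem hk))
    (fun x y hxy => boundState_injective hk (congrArg Subtype.val hxy))
  rwa [finrank_euclideanSpace_fin] at h

theorem two_lt_abs (hk : 1 < k) : 2 < |-k - 1 / k| := by
  have : k + 1 / k - 2 = (k - 1) ^ 2 / k := by field_simp; ring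
  have h2 : 0 < (k - 1) ^ 2 / k := div_pos (pow_pos (by linarith) 2) (by linarith)
  rw [abs_of_neg (by linarith)]
  linarith

theorem mem_outerEigenvalues (hm : 0 < m) (hk : 1 < k) :
    -k - 1 / k ∈ (jacobi m hk).outerEigenvalues := by
  refine ⟨two_lt_abs hk, fun h => ?_⟩
  have h1 := jacobi_multiplicity (m := m) hk
  have h2 : (jacobi m hk).eigenspace (-k - 1 / k) = ⊥ := h
  rw [MatrixJacobi.multiplicity, h2, finrank_bot] at h1
  omega

theorem jacobi_eigenTerm (hk : 1 < k) :
    (jacobi m hk).eigenTerm (-k - 1 / k) = m * moment k := by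
  have : k = kOf (-k - 1 / k) := (kOf_unique (two_lt_abs hk) k).mp
    ⟨by rwa [abs_of_pos (by linarith)], rfl⟩
  rw [MatrixJacobi.eigenTerm_eq, jacobi_multiplicity, ← this, abs_of_pos (by linarith)]

theorem summable_potentialTerm (hk : 1 < k) : Summable (jacobi m hk).potentialTerm := by
  simp only [funext (jacobi_potentialTerm (m := m) hk)]
  refine Summable.mul_left _ (Summable.of_nonneg_of_le (fun n => sq_nonneg _) (fun n => ?_)
    (hasSum_density hk).summable)
  have := log_quot_lt hk n
  rw [density]
  linarith

theorem summable_offDiagonalTerm (hk : 1 < k) : Summable (jacobi m hk).offDiagonalTerm := by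
  simp only [funext (jacobi_offDiagonalTerm (m := m) hk)]
  refine Summable.mul_left _ (Summable.of_nonneg_of_le (fun n => (log_quot_lt hk n).le)
    (fun n => ?_) (hasSum_density hk).summable)
  have := log_quot_lt hk n
  rw [density]
  nlinarith [sq_nonneg (ratio k n - ratio k (n + 1))]

theorem tsum_jacobi (hk : 1 < k) :
    (∑' n, (jacobi m hk).potentialTerm n) + 2 * ∑' n, (jacobi m hk).offDiagonalTerm n
      = m * moment k := by
  rw [← tsum_mul_left, ← (summable_potentialTerm hk).tsum_add
    ((summable_offDiagonalTerm hk).mul_left 2), ← ((hasSum_density hk).mul_left (m : ℝ)).tsum_eq]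
  refine tsum_congr fun n => ?_
  rw [jacobi_potentialTerm, jacobi_offDiagonalTerm, density]
  ring

/-- The known eigenvalue already saturates the inequality, so a second one, with its positive
weight, would violate it. -/
theorem outerEigenvalues_eq (hm : 0 < m) (hk : 1 < k) :
    (jacobi m hk).outerEigenvalues = {-k - 1 / k} := by
  refine Set.eq_singleton_iff_unique_mem.mpr ⟨mem_outerEigenvalues hm hk, fun μ hμ => ?_⟩
  by_contra hne
  have h := (jacobi m hk).sum_eigenTerm_le (summable_potentialTerm hk)
    (summable_offDiagonalTerm hk) {⟨μ, hμ⟩, ⟨_, mem_outerEigenvalues hm hk⟩}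
  rw [Finset.sum_pair (fun h => hne (congrArg Subtype.val h)), tsum_jacobi, jacobi_eigenTerm] at h
  have := (jacobi m hk).eigenTerm_pos hμ
  linarith

end Soliton

end

/-! ### The main theorem -/

theorem mainTheorem2 (m : ℕ) :
    -- `W` is self-adjoint, and its eigenvalues outside `[-2, 2]` have multiplicity at most `m`
    (∀ J : MatrixJacobi m, IsSelfAdjoint J.W ∧
      ∀ lam ∈ J.outerEigenvalues,
        FiniteDimensional ℂ (J.eigenspace lam) ∧ J.multiplicity lam ≤ m) ∧
    -- the inequality
    (∀ J : MatrixJacobi m, Summable J.potentialTerm → Summable J.offDiagonalTerm →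
      Summable (fun lam : J.outerEigenvalues => J.eigenTerm lam) ∧
      ∑' lam : J.outerEigenvalues, J.eigenTerm lam
        ≤ (∑' n : ℤ, J.potentialTerm n) + 2 * (∑' n : ℤ, J.offDiagonalTerm n)) ∧
    -- it is sharp: equality occurs for operators with any prescribed eigenvalue
    -- `-k - 1/k < -2`, with both sums on the right positive
    (0 < m → ∀ k : ℝ, 1 < k → ∃ J : MatrixJacobi m,
      Summable J.potentialTerm ∧ Summable J.offDiagonalTerm ∧
      J.outerEigenvalues = {-k - 1 / k} ∧
      0 < ∑' n : ℤ, J.potentialTerm n ∧ 0 < ∑' n : ℤ, J.offDiagonalTerm n ∧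
      ∑' lam : J.outerEigenvalues, J.eigenTerm lam
        = (∑' n : ℤ, J.potentialTerm n) + 2 * (∑' n : ℤ, J.offDiagonalTerm n)) ∧
    -- discrete Schrödinger operators with matrix-valued potential
    (∀ J : MatrixJacobi m, (∀ n, J.A n = -1) → Summable J.potentialTerm →
      Summable (fun lam : J.outerEigenvalues => J.eigenTerm lam) ∧
      ∑' lam : J.outerEigenvalues, J.eigenTerm lam ≤ ∑' n : ℤ, J.potentialTerm n) := by
  refine ⟨fun J => ⟨J.isSelfAdjoint_W, fun lam _ => ⟨J.finiteDimensional_eigenspace lam,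
      J.multiplicity_le lam⟩⟩,
    fun J hB hA => ⟨J.summable_eigenTerm hB hA, J.tsum_eigenTerm_le hB hA⟩, fun hm k hk => ?_,
    fun J hA hB => ?_⟩
  · have hm' : (0 : ℝ) < m := Nat.cast_pos.mpr hm
    refine ⟨Soliton.jacobi m hk, Soliton.summable_potentialTerm hk,
      Soliton.summable_offDiagonalTerm hk, Soliton.outerEigenvalues_eq hm hk, ?_, ?_, ?_⟩
    · refine (Soliton.summable_potentialTerm hk).tsum_pos (MatrixJacobi.potentialTerm_nonneg _) 0 ?_
      rw [Soliton.jacobi_potentialTerm]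
      have := sub_ne_zero.mpr (Soliton.ratio_lt_succ hk 0).ne
      positivity
    · refine (Soliton.summable_offDiagonalTerm hk).tsum_pos
        (MatrixJacobi.offDiagonalTerm_nonneg _) 0 ?_
      rw [Soliton.jacobi_offDiagonalTerm]
      exact mul_pos hm' (Soliton.log_quot_lt hk 0)
    · rw [Soliton.outerEigenvalues_eq hm hk, tsum_singleton _ (Soliton.jacobi m hk).eigenTerm,
        Soliton.jacobi_eigenTerm, Soliton.tsum_jacobi]
  · have h0 : J.offDiagonalTerm = fun _ => 0 := by
      funext n
      simp [MatrixJacobi.offDiagonalTerm, hA]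
    have hs : Summable J.offDiagonalTerm := by rw [h0]; exact summable_zero
    refine ⟨J.summable_eigenTerm hB hs, ?_⟩
    have h := J.tsum_eigenTerm_le hB hs
    rwa [h0, tsum_zero, mul_zero, add_zero] at h
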